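/- Let $C$ be a smooth manifold (finite-dimensional, Hausdorff, $\sigma$-compact, without boundary), let $\mathcal F$ be a (regular) foliation of $C$, and let $\omega_C\in\Omega^2(C)$ be a closed two-form such that $T\mathcal F=\ker\omega_C$. **Notation.** Let $N\mathcal F=TC/T\mathcal F$. For $X\in\Gamma(T\mathcal F)$, the Bott connection on $N\mathcal F$ is $\nabla_X\overline Y=\overline{[X,Y]}$, and the dual connection on $N^*\mathcal F$ is $\langle\nabla^*_X\beta,\overline Y\rangle=X\langle\beta,\overline Y\rangle-\langle\beta,\nabla_X\overline Y\rangle$. Both are flat. For a vector bundle $B$ with flat $T\mathcal F$-connection $\nabla$ let $d_\nabla$ be the (Koszul) differential on $\Omega^\bullet(\mathcal F;B)=\Gamma(\wedge^\bullet T^*\mathcal F\otimes B)$ and $H^\bullet(\mathcal F;B)$ its cohomology; for the trivial line bundle write $\Omega^\bullet(\mathcal F)$, $d_{\mathcal F}$, $H^\bullet(\mathcal F)$. The isomorphism $\omega_C^\flat:N\mathcal F\to N^*\mathcal F$, $\overline Y\mapsto\omega_C(Y,\cdot)$, is compatible with $\nabla$ and $\nabla^*$, hence so is its inverse, and $-\mathrm{Id}\otimes(\omega_C^\flat)^{-1}$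 induces a map $H^\bullet(\mathcal F;N^*\mathcal F)\to H^\bullet(\mathcal F;N\mathcal F)$. The transverse differentiation map is $$d_\nu:H^k(\mathcal F)\to H^k(\mathcal F;N^*\mathcal F),\qquad[\alpha]\mapsto[p(d\widetilde\alpha)],$$ where $\widetilde\alpha\in\Omega^k(C)$ is any extension of $\alpha$ and $\langle p(\beta)(V_1,\dots,V_k),\overline N\rangle=\beta(V_1,\dots,V_k,N)$ for every $\beta\in\Omega^{k+1}(C)$ that restricts to zero on the leaves. Let $G\subset TC$ be a smooth complement, $TC=T\mathcal F\oplus G$. Through $G\cong N\mathcal F$ the Bott connection becomes $\nabla_XY=\mathrm{pr}_G[X,Y]$ on $G$, and one has the isomorphism $\omega_C^\flat:G\to G^*$, $Y\mapsto\omega_C(Y,\cdot)$. Let $j:\Omega^k(\mathcal F)\to\Omega^k(C)$ be the extension of forms by zero on $G$. Define $\Phi:\Omega^k(\mathcal F)\to\Omega^k(\mathcal F;G)$ by taking the component of $d(j(\alpha))$ in $\Gamma(\wedge^kT^*\mathcal F\otimes G^*)$, i.e. $(V_1,\dots,V_k)\mapsto d(j(\alpha))(V_1,\dots,V_k,\cdot)|_G$,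 and applying $-\mathrm{Id}\otimes(\omega_C^\flat)^{-1}:\wedge^kT^*\mathcal F\otimes G^*\to\wedge^kT^*\mathcal F\otimes G$. **Proposition.** For every complement $G$ and every $k\ge0$: 0. $\langle\Phi(\alpha)(V_1,\dots,V_k),\beta\rangle=d(j(\alpha))\big(V_1,\dots,V_k,(\omega_C^\flat)^{-1}(\beta)\big)$ for all $\alpha\in\Omega^k(\mathcal F)$, $V_i\in\Gamma(T\mathcal F)$ and $\beta\in\Gamma(G^*)$. 1. $\Phi:(\Omega^\bullet(\mathcal F),d_{\mathcal F})\to(\Omega^\bullet(\mathcal F;G),d_\nabla)$ is a chain map up to sign: $\Phi\circ d_{\mathcal F}=-d_\nabla\circ\Phi$. 2. The map induced in cohomology by $\Phi$, followed by the identification $H^k(\mathcal F;G)\cong H^k(\mathcal F;N\mathcal F)$ coming from $G\cong N\mathcal F$, equals $$\big[-\mathrm{Id}\otimes(\omega_C^\flat)^{-1}\big]\circ d_\nu:H^k(\mathcal F)\to H^k(\mathcal F;N\mathcal F).$$ In particular it does not depend on the complement: any two complements $G,G'$ of $T\mathcal F$ induce the same map $H^k(\mathcal F)\to H^k(\mathcal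 F;N\mathcal F)$. -/

import Mathlib

set_option linter.unusedSectionVars false

noncomputable section

/-- A module with a flat connection over a Lie-Rinehart algebra `(A, L)`: the operator
`m ↦ ⁅x, m⁆` is the covariant derivative along `x`, so it is `A`-linear in `x` and a derivation
in `m`; flatness is the Jacobi identity contained in `LieRingModule`. -/
class FlatModule (A L M : Type*) [CommRing A] [LieRing L] [Module A L] [LieRingModule L A]
    [AddCommGroup M] [Module A M] [LieRingModule L M] : Prop where
  smul_lie' (a : A) (x : L) (m : M) : ⁅a • x, m⁆ = a • ⁅x, m⁆
  lie_smul' (x : L) (a : A) (m : M) : ⁅x, a • m⁆ = a • ⁅x, m⁆ + ⁅x, a⁆ • m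

instance {A L : Type*} [CommRing A] [LieRing L] [Module A L] [LieRingModule L A]
    [LieRinehartRing A L] : FlatModule A L A where
  smul_lie' a x m := by simp
  lie_smul' x a m := by simp

namespace LieForms

section Tuples

theorem removeNth_succ_vecCons {α : Type*} {n : ℕ} (i : Fin (n + 1)) (x : α) (W : Fin (n + 1) → α) :
    i.succ.removeNth (Matrix.vecCons x W) = Matrix.vecCons x (i.removeNth W) := by
  funext j
  refine Fin.cases ?_ (fun j => ?_) j <;> simp [Fin.removeNth]

theorem removeNth_zero_vecCons {α : Type*} {n : ℕ} (x : α) (W : Fin n → α) :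
    (0 : Fin (n + 1)).removeNth (Matrix.vecCons x W) = W := by
  funext j; simp [Fin.removeNth]

theorem map_vecCons_swap {A L M : Type*} [CommRing A] [AddCommGroup L] [Module A L]
    [AddCommGroup M] [Module A M] {n : ℕ} (η : L [⋀^Fin (n + 2)]→ₗ[A] M) (x y : L) (W : Fin n → L) :
    η (Matrix.vecCons x (Matrix.vecCons y W)) = -η (Matrix.vecCons y (Matrix.vecCons x W)) := by
  have h := η.map_swap (Matrix.vecCons y (Matrix.vecCons x W)) (i := 0) (j := 1) (by simp)
  rw [← h]
  congr 1
  funext j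
  refine Fin.cases ?_ (fun j => Fin.cases ?_ (fun j => ?_) j) j
  · simp
  · simp
  · simp only [Function.comp]
    rw [Equiv.swap_apply_of_ne_of_ne] <;> simp [Fin.ext_iff]

end Tuples

section Koszul

variable {A L M : Type*} [CommRing A] [Algebra ℝ A] [LieRing L] [Module A L] [LieRingModule L A]
  [LieAlgebra ℝ L] [LieRinehartRing A L] [LieRinehartAlgebra ℝ A L]
  [AddCommGroup M] [Module A M] [Module ℝ M] [IsScalarTower ℝ A M] [LieRingModule L M]
  [LieModule ℝ L M] [FlatModule A L M]

/-- The second sum of the Koszul formula. As there is no `η ([V₀, V₁], …)` in degree `0`, it is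
defined to vanish there; in degree `n + 1` the pair `i ≤ j` stands for the indices `i < j + 1`, so
the sign `(-1) ^ (i + (j + 1))` of the usual formula is `-(-1) ^ (i + j)`. -/
def bracketSum : {k : ℕ} → (L [⋀^Fin k]→ₗ[A] M) → (Fin (k + 1) → L) → M
  | 0, _, _ => 0
  | n + 1, η, V => -∑ i : Fin (n + 1), ∑ j ≥ i, (-1 : ℤ) ^ (i + j : ℕ) •
      η (Matrix.vecCons ⁅V i.castSucc, V j.succ⁆ (j.removeNth (i.castSucc.removeNth V)))

/-- The Koszul formula
`∑ i, (-1)^i ∇_{V i} (η (V₀, …, V̂ᵢ, …)) + ∑_{i<j} (-1)^(i+j) η ([Vᵢ, Vⱼ], …, V̂ᵢ, …, V̂ⱼ, …)`. -/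
def koszul {k : ℕ} (η : L [⋀^Fin k]→ₗ[A] M) (V : Fin (k + 1) → L) : M :=
  ∑ i : Fin (k + 1), (-1 : ℤ) ^ (i : ℕ) • ⁅V i, η (i.removeNth V)⁆ + bracketSum η V

/-- Forget `A`-linearity down to `ℝ`-linearity. -/
def realForm {k : ℕ} (η : L [⋀^Fin k]→ₗ[A] M) : L [⋀^Fin k]→ₗ[ℝ] M :=
  { MultilinearMap.restrictScalars ℝ η.toMultilinearMap with
    map_eq_zero_of_eq' := η.map_eq_zero_of_eq' }


@[simp]
theorem realForm_apply {k : ℕ} (η : L [⋀^Fin k]→ₗ[A] M) (V : Fin k → L) :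
    realForm η V = η V := rfl

/-- The Koszul formula as an alternating `ℝ`-multilinear map. -/
theorem exists_koszul_real {k : ℕ} (η : L [⋀^Fin k]→ₗ[A] M) :
    ∃ f : L [⋀^Fin (k + 1)]→ₗ[ℝ] M, ∀ V, f V = koszul η V := by
  let f₁ : L →ₗ[ℝ] L [⋀^Fin k]→ₗ[ℝ] M :=
    { toFun := fun x => (LieModule.toEnd ℝ L M x).compAlternatingMap (realForm η)
      map_add' := fun x y => by ext; simp
      map_smul' := fun c x => by ext; simp }
  have h₁ (V : Fin (k + 1) → L) : AlternatingMap.alternatizeUncurryFin f₁ V =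
      ∑ i : Fin (k + 1), (-1 : ℤ) ^ (i : ℕ) • ⁅V i, η (i.removeNth V)⁆ := by
    simp [AlternatingMap.alternatizeUncurryFin_apply, f₁]
  cases k with
  | zero => exact ⟨_, fun V => by rw [h₁, koszul, bracketSum, add_zero]⟩
  | succ n =>
    let g : L →ₗ[ℝ] L →ₗ[ℝ] L [⋀^Fin n]→ₗ[ℝ] M :=
      LinearMap.mk₂ ℝ (fun x y => (realForm η).curryLeft ⁅x, y⁆)
        (fun x y z => by simp) (fun c x y => by simp) (fun x y z => by simp)
        (fun c x y => by simp)
    refine ⟨AlternatingMap.alternatizeUncurryFin f₁ - (2 : ℝ)⁻¹ •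
      AlternatingMap.alternatizeUncurryFin (AlternatingMap.alternatizeUncurryFinLM ∘ₗ g),
      fun V => ?_⟩
    rw [AlternatingMap.sub_apply, AlternatingMap.smul_apply, h₁, koszul, bracketSum,
      AlternatingMap.alternatizeUncurryFin_alternatizeUncurryFinLM_comp_apply, sub_eq_add_neg]
    congr 2
    rw [inv_smul_eq_iff₀ two_ne_zero, Finset.smul_sum]
    refine Finset.sum_congr rfl fun i _ => ?_
    rw [Finset.smul_sum]
    refine Finset.sum_congr rfl fun j _ => ?_
    rw [smul_comm (2 : ℝ)]
    congr 1
    simp only [g, LinearMap.mk₂_apply, AlternatingMap.curryLeft_apply_apply, realForm_apply]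
    have e : η (Matrix.vecCons ⁅V j.succ, V i.castSucc⁆
        (j.removeNth (i.castSucc.removeNth V))) =
        -η (Matrix.vecCons ⁅V i.castSucc, V j.succ⁆ (j.removeNth (i.castSucc.removeNth V))) := by
      rw [← lie_skew (V j.succ) (V i.castSucc)]
      simpa using η.map_vecCons_smul (j.removeNth (i.castSucc.removeNth V)) (-1 : A)
        ⁅V i.castSucc, V j.succ⁆
    rw [e, sub_neg_eq_add, two_smul]

theorem koszul_vecCons_zero (η : L [⋀^Fin 0]→ₗ[A] M) (x : L) (V : Fin 0 → L) :
    koszul η (Matrix.vecCons x V) = ⁅x, η V⁆ := by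
  simp only [koszul, bracketSum, add_zero]
  simp [Subsingleton.elim _ V]

/-- Cartan's formula `ι_x d = L_x - d ι_x`. -/
theorem koszul_vecCons {n : ℕ} (η : L [⋀^Fin (n + 1)]→ₗ[A] M) (x : L) (W : Fin (n + 1) → L) :
    koszul η (Matrix.vecCons x W) = ⁅x, η W⁆ -
      ∑ j : Fin (n + 1), (-1 : ℤ) ^ (j : ℕ) • η (Matrix.vecCons ⁅x, W j⁆ (j.removeNth W)) -
      koszul (η.curryLeft x) W := by
  have hb : bracketSum η (Matrix.vecCons x W) =
      -(∑ j : Fin (n + 1), (-1 : ℤ) ^ (j : ℕ) • η (Matrix.vecCons ⁅x, W j⁆ (j.removeNth W))) -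
      bracketSum (η.curryLeft x) W := by
    rw [bracketSum, Fin.sum_univ_succ]
    have h0 : ∀ f : Fin (n + 1) → M, ∑ j ≥ (0 : Fin (n + 1)), f j = ∑ j, f j := by
      intro f; congr 1; ext; simp
    rw [h0, neg_add, sub_eq_add_neg]
    congr 1
    · congr 1
      refine Finset.sum_congr rfl fun j _ => ?_
      simp [removeNth_zero_vecCons, -Fin.removeNth_zero]
    · cases n with
      | zero => simp [bracketSum]
      | succ m =>
        rw [bracketSum, ← Finset.sum_neg_distrib, ← Finset.sum_neg_distrib, ← Finset.sum_neg_distrib]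
        refine Finset.sum_congr rfl fun i _ => ?_
        have h1 : ∀ f : Fin (m + 2) → M, ∑ j ≥ i.succ, f j = ∑ j ≥ i, f j.succ := by
          intro f
          have : Finset.Ici i.succ = (Finset.Ici i).map (Fin.succEmb (m + 1)) := by simp
          rw [this, Finset.sum_map]
          rfl
        rw [h1, neg_neg, ← Finset.sum_neg_distrib]
        refine Finset.sum_congr rfl fun j _ => ?_
        rw [← Fin.succ_castSucc, removeNth_succ_vecCons, removeNth_succ_vecCons,
          AlternatingMap.curryLeft_apply_apply, map_vecCons_swap]
        simp [pow_add]
  rw [koszul, koszul, hb, Fin.sum_univ_succ]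
  simp only [removeNth_succ_vecCons, removeNth_zero_vecCons, Matrix.cons_val_zero,
    Matrix.cons_val_succ, AlternatingMap.curryLeft_apply_apply, Fin.val_zero, pow_zero, one_smul,
    Fin.val_succ, pow_succ, mul_neg, mul_one, neg_smul, Finset.sum_neg_distrib]
  abel

theorem koszul_smul_zero {k : ℕ} (η : L [⋀^Fin k]→ₗ[A] M) (a : A) (x : L) (W : Fin k → L) :
    koszul η (Matrix.vecCons (a • x) W) = a • koszul η (Matrix.vecCons x W) := by
  induction k with
  | zero => rw [koszul_vecCons_zero, koszul_vecCons_zero, FlatModule.smul_lie']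
  | succ n ih =>
    have hl (y : L) : ⁅a • x, y⁆ = a • ⁅x, y⁆ - ⁅y, a⁆ • x := by
      rw [← lie_skew, LieRinehartRing.leibniz_smul_right, neg_add, ← smul_neg, lie_skew,
        sub_eq_add_neg]
    have hk : koszul (a • η.curryLeft x) W = a • koszul (η.curryLeft x) W +
        ∑ i : Fin (n + 1), (-1 : ℤ) ^ (i : ℕ) •
          ⁅W i, a⁆ • η (Matrix.vecCons x (i.removeNth W)) := by
      have hb : bracketSum (a • η.curryLeft x) W = a • bracketSum (η.curryLeft x) W := by
        cases n with
        | zero => simp [bracketSum]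
        | succ m =>
          simp only [bracketSum, AlternatingMap.smul_apply, smul_neg, Finset.smul_sum,
            smul_comm a ((-1 : ℤ) ^ _)]
      simp only [koszul, hb, AlternatingMap.smul_apply, FlatModule.lie_smul', smul_add,
        Finset.sum_add_distrib, Finset.smul_sum, smul_comm a ((-1 : ℤ) ^ _),
        AlternatingMap.curryLeft_apply_apply]
      abel
    rw [koszul_vecCons, koszul_vecCons, FlatModule.smul_lie', map_smul, hk]
    have hs : ∀ j : Fin (n + 1), η (Matrix.vecCons ⁅a • x, W j⁆ (j.removeNth W)) =
        a • η (Matrix.vecCons ⁅x, W j⁆ (j.removeNth W)) -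
          ⁅W j, a⁆ • η (Matrix.vecCons x (j.removeNth W)) := by
      intro j
      simp only [← AlternatingMap.curryLeft_apply_apply, hl, map_sub, map_smul,
        AlternatingMap.sub_apply, AlternatingMap.smul_apply]
    simp only [hs, smul_sub, Finset.sum_sub_distrib, Finset.smul_sum, smul_comm a ((-1 : ℤ) ^ _)]
    abel

theorem koszul_update_smul {k : ℕ} (η : L [⋀^Fin k]→ₗ[A] M) (V : Fin (k + 1) → L)
    (i : Fin (k + 1)) (a : A) (x : L) :
    koszul η (Function.update V i (a • x)) = a • koszul η (Function.update V i x) := by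
  obtain ⟨f, hf⟩ := exists_koszul_real η
  simp only [← Fin.insertNth_removeNth, ← hf, AlternatingMap.map_insertNth]
  rw [hf, hf, koszul_smul_zero, smul_comm]

/-- The differential of forms on a Lie-Rinehart algebra `(A, L)` with values in a module with a
flat connection, given by the Koszul formula. -/
def d {k : ℕ} : (L [⋀^Fin k]→ₗ[A] M) →ₗ[ℝ] (L [⋀^Fin (k + 1)]→ₗ[A] M) where
  toFun η :=
    { toFun := koszul η
      map_update_add' := by
        intro inst V i x y
        obtain ⟨f, hf⟩ := exists_koszul_real η
        rw [Subsingleton.elim inst (instDecidableEqFin (k + 1))]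
        simp only [← hf, AlternatingMap.map_update_add]
      map_update_smul' := by
        intro inst V i a x
        rw [Subsingleton.elim inst (instDecidableEqFin (k + 1))]
        exact koszul_update_smul η V i a x
      map_eq_zero_of_eq' := by
        intro V i j hV hij
        obtain ⟨f, hf⟩ := exists_koszul_real η
        simp only [← hf]
        exact f.map_eq_zero_of_eq V hV hij }
  map_add' η θ := by
    ext V
    change koszul (η + θ) V = koszul η V + koszul θ V
    cases k with
    | zero => simp [koszul, bracketSum]
    | succ n =>
      simp only [koszul, bracketSum, AlternatingMap.add_apply, lie_add, smul_add,
        Finset.sum_add_distrib]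
      abel
  map_smul' c η := by
    ext V
    change koszul (c • η) V = c • koszul η V
    cases k with
    | zero => simp [koszul, bracketSum]
    | succ n =>
      simp only [koszul, bracketSum, AlternatingMap.smul_apply, lie_smul, smul_add, smul_neg,
        Finset.smul_sum, smul_comm c ((-1 : ℤ) ^ _)]

theorem d_apply {k : ℕ} (η : L [⋀^Fin k]→ₗ[A] M) (V : Fin (k + 1) → L) : d η V = koszul η V := rfl

/-- Insertion of `x` in the first slot of a form. -/
def ins {k : ℕ} (x : L) : (L [⋀^Fin (k + 1)]→ₗ[A] M) →ₗ[ℝ] (L [⋀^Fin k]→ₗ[A] M) where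
  toFun η := η.curryLeft x
  map_add' _ _ := rfl
  map_smul' _ _ := rfl

theorem ins_apply {k : ℕ} (x : L) (η : L [⋀^Fin (k + 1)]→ₗ[A] M) (W : Fin k → L) :
    ins x η W = η (Matrix.vecCons x W) := rfl

theorem ext_ins {k : ℕ} {η θ : L [⋀^Fin (k + 1)]→ₗ[A] M} (h : ∀ x, ins x η = ins x θ) :
    η = θ := by
  ext V
  have := congrArg (fun f => f (Matrix.vecTail V)) (h (Matrix.vecHead V))
  simpa [ins_apply] using this

theorem ins_sub {k : ℕ} (x y : L) (η : L [⋀^Fin (k + 1)]→ₗ[A] M) :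
    ins (x - y) η = ins x η - ins y η := map_sub η.curryLeft x y

/-- The Lie derivative of a form. -/
def lieD (x : L) : {k : ℕ} → (L [⋀^Fin k]→ₗ[A] M) →ₗ[ℝ] (L [⋀^Fin k]→ₗ[A] M)
  | 0 => ins x ∘ₗ d
  | _ + 1 => ins x ∘ₗ d + d ∘ₗ ins x

theorem lieD_zero_apply (x : L) (η : L [⋀^Fin 0]→ₗ[A] M) (W : Fin 0 → L) :
    lieD x η W = ⁅x, η W⁆ := koszul_vecCons_zero η x W

theorem lieD_succ_apply {k : ℕ} (x : L) (η : L [⋀^Fin (k + 1)]→ₗ[A] M) (W : Fin (k + 1) → L) :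
    lieD x η W = ⁅x, η W⁆ -
      ∑ j : Fin (k + 1), (-1 : ℤ) ^ (j : ℕ) • η (Matrix.vecCons ⁅x, W j⁆ (j.removeNth W)) := by
  have h := koszul_vecCons η x W
  have : lieD x η W = koszul η (Matrix.vecCons x W) + koszul (η.curryLeft x) W := rfl
  rw [this, h, sub_add_cancel]

theorem ins_d_zero (x : L) (η : L [⋀^Fin 0]→ₗ[A] M) : ins x (d η) = lieD x η := rfl

theorem ins_d_succ {k : ℕ} (x : L) (η : L [⋀^Fin (k + 1)]→ₗ[A] M) :
    ins x (d η) = lieD x η - d (ins x η) := by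
  have : lieD x η = ins x (d η) + d (ins x η) := rfl
  rw [this, add_sub_cancel_right]

theorem ins_lieD {k : ℕ} (x y : L) (η : L [⋀^Fin (k + 1)]→ₗ[A] M) :
    ins y (lieD x η) = lieD x (ins y η) - ins ⁅x, y⁆ η := by
  ext W
  rw [ins_apply, lieD_succ_apply, AlternatingMap.sub_apply, ins_apply]
  cases k with
  | zero =>
    rw [lieD_zero_apply, ins_apply]
    simp [Subsingleton.elim (Fin.tail (Matrix.vecCons y W)) W]
  | succ n =>
    rw [lieD_succ_apply, Fin.sum_univ_succ]
    simp only [removeNth_succ_vecCons, removeNth_zero_vecCons, Matrix.cons_val_zero,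
      Matrix.cons_val_succ, Fin.val_zero, pow_zero, one_smul, ins_apply, map_vecCons_swap η _ y,
      Fin.val_succ, pow_succ, mul_neg, mul_one, neg_smul, smul_neg, neg_neg]
    abel

theorem lieD_lieD {k : ℕ} (x y : L) (η : L [⋀^Fin k]→ₗ[A] M) :
    lieD x (lieD y η) - lieD y (lieD x η) = lieD ⁅x, y⁆ η := by
  induction k with
  | zero =>
    ext W
    simp only [AlternatingMap.sub_apply, lieD_zero_apply, lie_lie]
  | succ n ih =>
    refine ext_ins fun z => ?_
    have hz : ⁅⁅x, y⁆, z⁆ = ⁅x, ⁅y, z⁆⁆ - ⁅y, ⁅x, z⁆⁆ := by rw [lie_lie]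
    rw [map_sub]
    simp only [ins_lieD, map_sub, hz, ins_sub, ← ih]
    abel

theorem d_lieD {k : ℕ} (x : L) (η : L [⋀^Fin k]→ₗ[A] M) : d (lieD x η) = lieD x (d η) := by
  induction k with
  | zero =>
    refine ext_ins fun y => ?_
    rw [ins_d_zero, ins_lieD, ins_d_zero, ins_d_zero, ← lieD_lieD]
    abel
  | succ n ih =>
    refine ext_ins fun y => ?_
    rw [ins_d_succ, ins_lieD, ins_lieD, ins_d_succ, ins_d_succ, ← lieD_lieD, map_sub, map_sub, ih]
    abel

theorem d_d {k : ℕ} (η : L [⋀^Fin k]→ₗ[A] M) : d (d η) = 0 := by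
  induction k with
  | zero =>
    refine ext_ins fun y => ?_
    rw [ins_d_succ, ins_d_zero, d_lieD, sub_self, map_zero]
  | succ n ih =>
    refine ext_ins fun y => ?_
    rw [ins_d_succ, ins_d_succ, map_sub, ih, d_lieD, sub_zero, sub_self, map_zero]

end Koszul

section Cohomology

variable (A L M : Type*) [CommRing A] [Algebra ℝ A] [LieRing L] [Module A L] [LieRingModule L A]
  [LieAlgebra ℝ L] [LieRinehartRing A L] [LieRinehartAlgebra ℝ A L]
  [AddCommGroup M] [Module A M] [Module ℝ M] [IsScalarTower ℝ A M] [LieRingModule L M]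
  [LieModule ℝ L M] [FlatModule A L M]

/-- Closed forms of degree `k`. -/
def cocycles (k : ℕ) : Submodule ℝ (L [⋀^Fin k]→ₗ[A] M) := LinearMap.ker d

/-- Exact forms of degree `k`. -/
def coboundaries : (k : ℕ) → Submodule ℝ (L [⋀^Fin k]→ₗ[A] M)
  | 0 => ⊥
  | _ + 1 => LinearMap.range d

/-- The cohomology `H^k` of `(A, L)` with coefficients in the flat module `M`. -/
abbrev Cohomology (k : ℕ) : Type _ :=
  cocycles A L M k ⧸ (coboundaries A L M k).submoduleOf (cocycles A L M k)

variable {A L M}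

/-- The cohomology class of a closed form. -/
def cls {k : ℕ} (η : L [⋀^Fin k]→ₗ[A] M) (h : d η = 0) : Cohomology A L M k :=
  Submodule.Quotient.mk ⟨η, LinearMap.mem_ker.2 h⟩

theorem cls_eq {k : ℕ} {η θ : L [⋀^Fin k]→ₗ[A] M} (hη : d η = 0) (hθ : d θ = 0)
    (h : η - θ ∈ coboundaries A L M k) : cls η hη = cls θ hθ :=
  (Submodule.Quotient.eq ((coboundaries A L M k).submoduleOf (cocycles A L M k))).2 h

theorem cls_eq_zero {k : ℕ} {η : L [⋀^Fin k]→ₗ[A] M} (hη : d η = 0)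
    (h : η ∈ coboundaries A L M k) : cls η hη = 0 :=
  (Submodule.Quotient.mk_eq_zero ((coboundaries A L M k).submoduleOf (cocycles A L M k))).2 h

theorem cls_add {k : ℕ} {η θ ζ : L [⋀^Fin k]→ₗ[A] M} (hη : d η = 0) (hθ : d θ = 0) (hζ : d ζ = 0)
    (h : ζ = η + θ) : cls ζ hζ = cls η hη + cls θ hθ := by
  subst h; rfl

theorem cls_smul {k : ℕ} {η ζ : L [⋀^Fin k]→ₗ[A] M} (hη : d η = 0) (hζ : d ζ = 0) (c : ℝ)
    (h : ζ = c • η) : cls ζ hζ = c • cls η hη := by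
  subst h; rfl

variable {L' M' : Type*} [LieRing L'] [Module A L'] [LieRingModule L' A]
  [LieAlgebra ℝ L'] [LieRinehartRing A L'] [LieRinehartAlgebra ℝ A L']
  [AddCommGroup M'] [Module A M'] [Module ℝ M'] [IsScalarTower ℝ A M'] [LieRingModule L' M']
  [LieModule ℝ L' M'] [FlatModule A L' M']

/-- A family of linear maps between two complexes that commutes with the differentials, or
anticommutes with them. -/
def IsChainMapUpToSign (f : ∀ k, (L [⋀^Fin k]→ₗ[A] M) →ₗ[ℝ] (L' [⋀^Fin k]→ₗ[A] M')) : Prop :=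
  (∀ k η, f (k + 1) (d η) = d (f k η)) ∨ (∀ k η, f (k + 1) (d η) = -d (f k η))

/-- The map in cohomology `[η] ↦ [f η]` induced by a chain map up to sign. -/
def cohMap (f : ∀ k, (L [⋀^Fin k]→ₗ[A] M) →ₗ[ℝ] (L' [⋀^Fin k]→ₗ[A] M'))
    (hf : IsChainMapUpToSign f) (k : ℕ) : Cohomology A L M k →ₗ[ℝ] Cohomology A L' M' k :=
  have h₀ : ∀ η ∈ cocycles A L M k, f k η ∈ cocycles A L' M' k := by
    intro η hη
    have hη' : d η = 0 := hη
    change d (f k η) = 0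
    rcases hf with hf | hf
    · rw [← hf, hη', map_zero]
    · rw [← neg_eq_zero, ← hf, hη', map_zero]
  Submodule.mapQ _ _ ((f k).restrict h₀) (by
    rintro ⟨η, hη⟩ h
    change η ∈ coboundaries A L M k at h
    change f k η ∈ coboundaries A L' M' k
    cases k with
    | zero =>
      have h : η = 0 := h
      rw [h, map_zero]
      exact zero_mem _
    | succ n =>
      obtain ⟨θ, rfl⟩ := h
      rcases hf with hf | hf
      · exact ⟨f n θ, (hf n θ).symm⟩
      · exact ⟨-f n θ, by rw [map_neg, hf]⟩)

theorem cohMap_cls (f : ∀ k, (L [⋀^Fin k]→ₗ[A] M) →ₗ[ℝ] (L' [⋀^Fin k]→ₗ[A] M'))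
    (hf : IsChainMapUpToSign f) {k : ℕ} (η : L [⋀^Fin k]→ₗ[A] M) (h : d η = 0)
    (h' : d (f k η) = 0) : cohMap f hf k (cls η h) = cls (f k η) h' := rfl

end Cohomology

section Coefficients

variable {A L M M' : Type*} [CommRing A] [Algebra ℝ A] [LieRing L] [Module A L] [LieRingModule L A]
  [LieAlgebra ℝ L] [LieRinehartRing A L] [LieRinehartAlgebra ℝ A L]
  [AddCommGroup M] [Module A M] [Module ℝ M] [IsScalarTower ℝ A M] [LieRingModule L M]
  [LieModule ℝ L M] [FlatModule A L M]
  [AddCommGroup M'] [Module A M'] [Module ℝ M'] [IsScalarTower ℝ A M'] [LieRingModule L M']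
  [LieModule ℝ L M'] [FlatModule A L M']

/-- `Id ⊗ φ` on forms with coefficients. -/
def mapCoeff (φ : M →ₗ[A] M') (k : ℕ) : (L [⋀^Fin k]→ₗ[A] M) →ₗ[ℝ] (L [⋀^Fin k]→ₗ[A] M') where
  toFun η := φ.compAlternatingMap η
  map_add' η θ := by ext; simp
  map_smul' c η := by ext; exact LinearMap.map_smul_of_tower φ c _

theorem mapCoeff_d (φ : M →ₗ[A] M') (hφ : ∀ (x : L) m, φ ⁅x, m⁆ = ⁅x, φ m⁆) (k : ℕ)
    (η : L [⋀^Fin k]→ₗ[A] M) : mapCoeff φ (k + 1) (d η) = d (mapCoeff φ k η) := by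
  ext V
  change φ (koszul η V) = koszul (φ.compAlternatingMap η) V
  cases k <;> simp [koszul, bracketSum, hφ]

end Coefficients


section Subalgebra

variable {A L : Type*} [CommRing A] [Algebra ℝ A] [LieRing L] [Module A L] [LieRingModule L A]
  [LieAlgebra ℝ L] [LieRinehartRing A L] [LieRinehartAlgebra ℝ A L]

instance (S : LieRinehartSubalgebra A L) (M : Type*) [AddCommGroup M] [Module A M]
    [LieRingModule L M] [FlatModule A L M] : FlatModule A S M where
  smul_lie' a x m := FlatModule.smul_lie' a (x : L) m
  lie_smul' x a m := FlatModule.lie_smul' (x : L) a m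

/-- The inclusion of a subalgebra, as an `A`-linear map. -/
def incl (S : LieRinehartSubalgebra A L) : S →ₗ[A] L := S.toSubmodule.subtype

@[simp]
theorem incl_apply (S : LieRinehartSubalgebra A L) (x : S) : incl S x = x := rfl

/-- The normal module `L / S`. -/
abbrev Normal (S : LieRinehartSubalgebra A L) : Type _ := L ⧸ S.toSubmodule

/-- The class of `y` in the normal module. -/
abbrev toNormal (S : LieRinehartSubalgebra A L) : L →ₗ[A] Normal S := S.toSubmodule.mkQ

/-- The Bott connection `∇_x ȳ = [x, y]‾` on the normal module. -/
instance bott (S : LieRinehartSubalgebra A L) : LieRingModule S (Normal S) where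
  bracket x n := Quotient.liftOn' n (fun y : L => toNormal S ⁅(x : L), y⁆) (by
    intro y z h
    have h' : y - z ∈ S.toSubmodule := (Submodule.quotientRel_def _).1 h
    refine (Submodule.Quotient.eq _).2 ?_
    rw [← lie_sub]
    exact S.lie_mem x.2 h')
  add_lie x y n := by
    obtain ⟨n, rfl⟩ := Submodule.mkQ_surjective _ n
    exact (congrArg (toNormal S) (add_lie (x : L) y n)).trans (map_add _ _ _)
  lie_add x m n := by
    obtain ⟨m, rfl⟩ := Submodule.mkQ_surjective _ m
    obtain ⟨n, rfl⟩ := Submodule.mkQ_surjective _ n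
    exact (congrArg (toNormal S) (lie_add (x : L) m n)).trans (map_add _ _ _)
  leibniz_lie x y n := by
    obtain ⟨n, rfl⟩ := Submodule.mkQ_surjective _ n
    exact (congrArg (toNormal S) (leibniz_lie (x : L) (y : L) n)).trans (map_add _ _ _)

theorem lie_toNormal (S : LieRinehartSubalgebra A L) (x : S) (y : L) :
    ⁅x, toNormal S y⁆ = toNormal S ⁅(x : L), y⁆ := rfl

instance (S : LieRinehartSubalgebra A L) : LieModule ℝ S (Normal S) where
  smul_lie c x n := by
    obtain ⟨n, rfl⟩ := Submodule.mkQ_surjective _ n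
    exact (congrArg (toNormal S) (smul_lie c (x : L) n)).trans
      (LinearMap.map_smul_of_tower (toNormal S) c _)
  lie_smul c x n := by
    obtain ⟨n, rfl⟩ := Submodule.mkQ_surjective _ n
    exact (congrArg (toNormal S) (lie_smul c (x : L) n)).trans
      (LinearMap.map_smul_of_tower (toNormal S) c _)

instance (S : LieRinehartSubalgebra A L) : FlatModule A S (Normal S) where
  smul_lie' a x n := by
    obtain ⟨n, rfl⟩ := Submodule.mkQ_surjective _ n
    have h : ⁅a • (x : L), n⁆ = a • ⁅(x : L), n⁆ - ⁅n, a⁆ • (x : L) := by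
      rw [← lie_skew, LieRinehartRing.leibniz_smul_right, neg_add, ← smul_neg, lie_skew,
        sub_eq_add_neg]
    change toNormal S ⁅a • (x : L), n⁆ = a • toNormal S ⁅(x : L), n⁆
    rw [h, map_sub, map_smul, sub_eq_self]
    exact (Submodule.Quotient.mk_eq_zero _).2 (S.smul_mem _ x.2)
  lie_smul' x a n := by
    obtain ⟨n, rfl⟩ := Submodule.mkQ_surjective _ n
    change toNormal S ⁅(x : L), a • n⁆ = a • toNormal S ⁅(x : L), n⁆ + ⁅(x : L), a⁆ • toNormal S n
    rw [LieRinehartRing.leibniz_smul_right, map_add, map_smul, map_smul]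

/-- The conormal module, i.e. the dual of the normal module. -/
abbrev Conormal (S : LieRinehartSubalgebra A L) : Type _ := Module.Dual A (Normal S)

/-- The dual connection, `⟨n, ∇*_x β⟩ = x ⟨n, β⟩ - ⟨∇_x n, β⟩`. -/
instance dualBott (S : LieRinehartSubalgebra A L) : LieRingModule S (Conormal S) where
  bracket x β :=
    { toFun := fun n => ⁅x, β n⁆ - β ⁅x, n⁆
      map_add' := fun m n => by simp only [map_add, lie_add]; abel
      map_smul' := fun a n => by
        rw [FlatModule.lie_smul', map_add, map_smul, map_smul, map_smul, FlatModule.lie_smul',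
          RingHom.id_apply, smul_sub]
        abel }
  add_lie x y β := by
    ext n
    change ⁅x + y, β (toNormal S n)⁆ - β ⁅x + y, toNormal S n⁆ = (⁅x, _⁆ - β _) + (⁅y, _⁆ - β _)
    simp only [add_lie, map_add]
    abel
  lie_add x β γ := by
    ext n
    change ⁅x, β (toNormal S n) + γ (toNormal S n)⁆ - (β _ + γ _) = (⁅x, _⁆ - β _) + (⁅x, _⁆ - γ _)
    simp only [lie_add]
    abel
  leibniz_lie x y β := by
    ext n
    change ⁅x, ⁅y, β (toNormal S n)⁆ - β ⁅y, toNormal S n⁆⁆ -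
      (⁅y, β ⁅x, toNormal S n⁆⁆ - β ⁅y, ⁅x, toNormal S n⁆⁆) =
      (⁅⁅x, y⁆, β (toNormal S n)⁆ - β ⁅⁅x, y⁆, toNormal S n⁆) +
      (⁅y, ⁅x, β (toNormal S n)⁆ - β ⁅x, toNormal S n⁆⁆ -
      (⁅x, β ⁅y, toNormal S n⁆⁆ - β ⁅x, ⁅y, toNormal S n⁆⁆))
    simp only [lie_sub, leibniz_lie x y (β _), leibniz_lie x y (toNormal S n), map_add]
    abel

theorem lie_conormal_apply (S : LieRinehartSubalgebra A L) (x : S) (β : Conormal S)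
    (n : Normal S) : ⁅x, β⁆ n = ⁅x, β n⁆ - β ⁅x, n⁆ := rfl

instance (S : LieRinehartSubalgebra A L) : LieModule ℝ S (Conormal S) where
  smul_lie c x β := by
    refine LinearMap.ext fun n => ?_
    rw [lie_conormal_apply, LinearMap.smul_apply, lie_conormal_apply, smul_lie, smul_lie,
      LinearMap.map_smul_of_tower, smul_sub]
  lie_smul c x β := by
    refine LinearMap.ext fun n => ?_
    rw [lie_conormal_apply, LinearMap.smul_apply, LinearMap.smul_apply, LinearMap.smul_apply,
      lie_conormal_apply, lie_smul, smul_sub]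

instance (S : LieRinehartSubalgebra A L) : FlatModule A S (Conormal S) where
  smul_lie' a x β := by
    refine LinearMap.ext fun n => ?_
    rw [lie_conormal_apply, LinearMap.smul_apply, lie_conormal_apply, FlatModule.smul_lie',
      FlatModule.smul_lie', map_smul, smul_sub]
  lie_smul' x a β := by
    refine LinearMap.ext fun n => ?_
    simp only [lie_conormal_apply, LinearMap.smul_apply, LinearMap.add_apply,
      FlatModule.lie_smul', smul_sub]
    abel

/-- Restriction of forms to a subalgebra. -/
def restrict (S : LieRinehartSubalgebra A L) (k : ℕ) :
    (L [⋀^Fin k]→ₗ[A] A) →ₗ[ℝ] (S [⋀^Fin k]→ₗ[A] A) where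
  toFun η := η.compLinearMap (incl S)
  map_add' _ _ := rfl
  map_smul' _ _ := rfl

theorem restrict_d (S : LieRinehartSubalgebra A L) (k : ℕ) (η : L [⋀^Fin k]→ₗ[A] A) :
    restrict S (k + 1) (d η) = d (restrict S k η) := by
  ext V
  change koszul η (fun i => (V i : L)) = koszul (η.compLinearMap (incl S)) V
  cases k with
  | zero => rfl
  | succ n =>
    rw [koszul, koszul, bracketSum, bracketSum]
    congr 2
    refine Finset.sum_congr rfl fun i _ => Finset.sum_congr rfl fun j _ => ?_
    congr 1
    change η _ = η _
    congr 1
    funext l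
    refine Fin.cases ?_ (fun l => ?_) l <;> simp [Fin.removeNth]

/-- The forms that vanish on the subalgebra. -/
def relForms (S : LieRinehartSubalgebra A L) (k : ℕ) : Submodule ℝ (L [⋀^Fin k]→ₗ[A] A) :=
  LinearMap.ker (restrict S k)

theorem d_mem_relForms {S : LieRinehartSubalgebra A L} {k : ℕ} {η : L [⋀^Fin k]→ₗ[A] A}
    (h : η ∈ relForms S k) : d η ∈ relForms S (k + 1) := by
  have h : restrict S k η = 0 := h
  change restrict S (k + 1) (d η) = 0
  rw [restrict_d, h, map_zero]

theorem map_snoc {M Q : Type*} [AddCommGroup M] [Module A M] [AddCommGroup Q] [Module A Q] {k : ℕ}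
    (η : Q [⋀^Fin (k + 1)]→ₗ[A] M) (V : Fin k → Q) (x : Q) :
    η (Fin.snoc V x) = (-1 : ℤ) ^ k • η (Matrix.vecCons x V) := by
  rw [← Fin.insertNth_last', AlternatingMap.map_insertNth, Fin.val_last]

/-- The component of a `(k + 1)`-form with `k` arguments in the subalgebra `S` and the last argument
in a second module `Q → L`, as a `k`-form on `S` with values in the dual of `Q`:
`⟨η (V₁, …, V_k), q⟩ = η (V₁, …, V_k, q)`. -/
def mixed (S : LieRinehartSubalgebra A L) {Q : Type*} [AddCommGroup Q] [Module A Q]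
    (ι : Q →ₗ[A] L) (k : ℕ) :
    (L [⋀^Fin (k + 1)]→ₗ[A] A) →ₗ[ℝ] (S [⋀^Fin k]→ₗ[A] Module.Dual A Q) where
  toFun η :=
    { toFun := fun V =>
        { toFun := fun q => η (Fin.snoc (fun i => (V i : L)) (ι q))
          map_add' := fun p q => by
            simp only [map_snoc, map_add, AlternatingMap.map_vecCons_add, smul_add]
          map_smul' := fun a q => by
            simp only [map_snoc, map_smul, AlternatingMap.map_vecCons_smul, RingHom.id_apply]
            rw [smul_comm] }
      map_update_add' := fun V i x y => by
        ext q
        have h (z : S) : (fun l => ((Function.update V i z) l : L)) =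
            Function.update (fun l => (V l : L)) i z := by
          funext l; by_cases hl : l = i
          · subst hl; simp
          · simp [hl]
        simp only [LinearMap.coe_mk, AddHom.coe_mk, LinearMap.add_apply, map_snoc, h, ← ins_apply]
        rw [← smul_add]
        exact congrArg _ ((ins (ι q) η).map_update_add _ _ _ _)
      map_update_smul' := fun V i a x => by
        ext q
        have h (z : S) : (fun l => ((Function.update V i z) l : L)) =
            Function.update (fun l => (V l : L)) i z := by
          funext l; by_cases hl : l = i
          · subst hl; simp
          · simp [hl]
        simp only [LinearMap.coe_mk, AddHom.coe_mk, LinearMap.smul_apply, map_snoc, h, ← ins_apply]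
        rw [smul_comm]
        exact congrArg _ ((ins (ι q) η).map_update_smul _ _ _ _)
      map_eq_zero_of_eq' := fun V i j hV hij => by
        ext q
        simp only [LinearMap.coe_mk, AddHom.coe_mk, LinearMap.zero_apply, map_snoc, ← ins_apply]
        rw [(ins (ι q) η).map_eq_zero_of_eq _ (congrArg Subtype.val hV) hij, smul_zero] }
  map_add' _ _ := rfl
  map_smul' _ _ := rfl

theorem mixed_apply (S : LieRinehartSubalgebra A L) {Q : Type*} [AddCommGroup Q] [Module A Q]
    (ι : Q →ₗ[A] L) (k : ℕ) (η : L [⋀^Fin (k + 1)]→ₗ[A] A) (V : Fin k → S) (q : Q) :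
    mixed S ι k η V q = η (Fin.snoc (fun i => (V i : L)) (ι q)) := rfl

/-- The map `p : β ↦ p β` from forms vanishing on the subalgebra to forms with values in the
conormal module, `⟨(p β) (V₁, …, V_k), N‾⟩ = β (V₁, …, V_k, N)`. -/
def conormalPart (S : LieRinehartSubalgebra A L) (k : ℕ) :
    relForms S (k + 1) →ₗ[ℝ] (S [⋀^Fin k]→ₗ[A] Conormal S) where
  toFun β :=
    { toFun := fun V => S.toSubmodule.liftQ (mixed S LinearMap.id k β V) (by
        intro x hx
        have h : restrict S (k + 1) β = 0 := β.2
        have h' := congrArg (fun η => η (Fin.snoc V (⟨x, hx⟩ : S))) h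
        change (β : L [⋀^Fin (k + 1)]→ₗ[A] A) _ = 0
        change (β : L [⋀^Fin (k + 1)]→ₗ[A] A) _ = 0 at h'
        rw [← h']
        congr 1
        funext i
        refine Fin.lastCases ?_ (fun i => ?_) i <;> simp)
      map_update_add' := fun V i x y => by
        refine LinearMap.ext fun n => ?_
        obtain ⟨n, rfl⟩ := Submodule.mkQ_surjective _ n
        exact congrArg (fun f => f n) ((mixed S LinearMap.id k β).map_update_add V i x y)
      map_update_smul' := fun V i a x => by
        refine LinearMap.ext fun n => ?_
        obtain ⟨n, rfl⟩ := Submodule.mkQ_surjective _ n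
        exact congrArg (fun f => f n) ((mixed S LinearMap.id k β).map_update_smul V i a x)
      map_eq_zero_of_eq' := fun V i j hV hij => by
        refine LinearMap.ext fun n => ?_
        obtain ⟨n, rfl⟩ := Submodule.mkQ_surjective _ n
        exact congrArg (fun f => f n) ((mixed S LinearMap.id k β).map_eq_zero_of_eq V hV hij) }
  map_add' β γ := by
    ext V n
    rfl
  map_smul' c β := by
    ext V n
    rfl

theorem conormalPart_apply (S : LieRinehartSubalgebra A L) (k : ℕ) (β : relForms S (k + 1))
    (V : Fin k → S) (n : L) : conormalPart S k β V (toNormal S n) =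
      (β : L [⋀^Fin (k + 1)]→ₗ[A] A) (Fin.snoc (fun i => (V i : L)) n) := rfl

theorem koszul_incl (S : LieRinehartSubalgebra A L) {k : ℕ} (η : L [⋀^Fin k]→ₗ[A] A)
    (V : Fin (k + 1) → S) : koszul η (fun i => (V i : L)) = koszul (restrict S k η) V :=
  congrArg (fun f => f V) (restrict_d S k η)

theorem conormalPart_d (S : LieRinehartSubalgebra A L) (k : ℕ) (β : relForms S (k + 1)) :
    conormalPart S (k + 1) ⟨d β, d_mem_relForms β.2⟩ = d (conormalPart S k β) := by
  obtain ⟨β, hβ⟩ := β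
  have hβ' : restrict S (k + 1) β = 0 := hβ
  ext V n
  change d β (Fin.snoc (fun i => (V i : L)) n) = koszul (conormalPart S k ⟨β, hβ⟩) V (toNormal S n)
  have hV : β (fun i => (V i : L)) = 0 := congrArg (fun f => f V) hβ'
  have e (W : Fin k → S) : conormalPart S k ⟨β, hβ⟩ W (toNormal S n) =
      (-1 : ℤ) ^ k • (restrict S k (ins n β)) W := by
    rw [conormalPart_apply, map_snoc]; rfl
  have hb : bracketSum (conormalPart S k ⟨β, hβ⟩) V (toNormal S n) =
      (-1 : ℤ) ^ k • bracketSum (restrict S k (ins n β)) V := by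
    cases k with
    | zero => simp [bracketSum]
    | succ m =>
      simp only [bracketSum, LinearMap.neg_apply, LinearMap.sum_apply, LinearMap.smul_apply, e,
        smul_neg, Finset.smul_sum, smul_comm ((-1 : ℤ) ^ (m + 1))]
  rw [map_snoc, d_apply, koszul_vecCons, hV, lie_zero, zero_sub]
  change _ • (_ - koszul (ins n β) _) = _
  rw [koszul_incl]
  rw [koszul, koszul, LinearMap.add_apply, hb, LinearMap.sum_apply]
  simp only [LinearMap.smul_apply, lie_conormal_apply, e, lie_toNormal]
  simp only [conormalPart_apply, map_snoc]
  have hs (i : Fin (k + 1)) : β (Matrix.vecCons ⁅n, (V i : L)⁆ (i.removeNth fun i => (V i : L))) =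
      - β (Matrix.vecCons ⁅(V i : L), n⁆ (fun j => ((i.removeNth V) j : L))) := by
    rw [← lie_skew]
    exact congrArg (fun f => f (fun j => ((i.removeNth V) j : L)))
      (map_neg β.curryLeft ⁅(V i : L), n⁆)
  simp only [hs, smul_neg, Finset.sum_neg_distrib, smul_sub, Finset.sum_sub_distrib, lie_zsmul,
    smul_add, neg_neg, Finset.smul_sum, pow_succ, mul_neg, mul_one, neg_smul,
    smul_comm ((-1 : ℤ) ^ k)]
  abel

end Subalgebra

section Transverse

variable {A L : Type*} [CommRing A] [Algebra ℝ A] [LieRing L] [Module A L] [LieRingModule L A]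
  [LieAlgebra ℝ L] [LieRinehartRing A L] [LieRinehartAlgebra ℝ A L]

/-- The extension of forms on the subalgebra by zero along the kernel of a projection `P`. -/
def extend {S : LieRinehartSubalgebra A L} (P : L →ₗ[A] S) (k : ℕ) :
    (S [⋀^Fin k]→ₗ[A] A) →ₗ[ℝ] (L [⋀^Fin k]→ₗ[A] A) where
  toFun α := α.compLinearMap P
  map_add' _ _ := rfl
  map_smul' _ _ := rfl

theorem restrict_extend {S : LieRinehartSubalgebra A L} (P : L →ₗ[A] S) (hP : ∀ x : S, P x = x)
    (k : ℕ) (α : S [⋀^Fin k]→ₗ[A] A) : restrict S k (extend P k α) = α := by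
  ext V
  exact congrArg α (funext fun i => hP (V i))

theorem d_extension_mem (S : LieRinehartSubalgebra A L) {k : ℕ} (η : L [⋀^Fin k]→ₗ[A] A)
    (h : d (restrict S k η) = 0) : d η ∈ relForms S (k + 1) := by
  change restrict S (k + 1) (d η) = 0
  rw [restrict_d, h]

theorem d_conormalPart_d (S : LieRinehartSubalgebra A L) {k : ℕ} (η : L [⋀^Fin k]→ₗ[A] A)
    (h : d η ∈ relForms S (k + 1)) : d (conormalPart S k ⟨d η, h⟩) = 0 := by
  rw [← conormalPart_d]
  have : (⟨d (d η), d_mem_relForms h⟩ : relForms S (k + 1 + 1)) = 0 := Subtype.ext (d_d η)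
  exact (congrArg _ this).trans (map_zero _)

theorem conormalPart_d_mem (S : LieRinehartSubalgebra A L) {k : ℕ} (β : L [⋀^Fin k]→ₗ[A] A)
    (h : restrict S k β ∈ coboundaries A S A k) (hd : d β ∈ relForms S (k + 1))
    (hext : ∀ n, Function.Surjective (restrict S n)) :
    conormalPart S k ⟨d β, hd⟩ ∈ coboundaries A S (Conormal S) k := by
  cases k with
  | zero =>
    have h : restrict S 0 β = 0 := h
    have hβ : β = 0 := by
      ext V
      have := congrArg (fun f => f (fun i => i.elim0)) h
      rw [AlternatingMap.zero_apply]
      refine Eq.trans ?_ this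
      exact congrArg β (Subsingleton.elim _ _)
    subst hβ
    have : (⟨d 0, hd⟩ : relForms S (0 + 1)) = 0 := Subtype.ext (map_zero _)
    rw [this, map_zero]
    exact zero_mem _
  | succ n =>
    obtain ⟨γ, hγ⟩ := h
    obtain ⟨γ', rfl⟩ := hext n γ
    have hm : β - d γ' ∈ relForms S (n + 1) := by
      change restrict S (n + 1) (β - d γ') = 0
      rw [map_sub, restrict_d, hγ, sub_self]
    refine ⟨conormalPart S n ⟨β - d γ', hm⟩, ?_⟩
    rw [← conormalPart_d]
    congr 2
    change d (β - d γ') = d β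
    rw [map_sub, d_d, sub_zero]

theorem cls_conormalPart_eq (S : LieRinehartSubalgebra A L)
    (hS : ∀ n, Function.Surjective (restrict S n)) {k : ℕ} (η θ : L [⋀^Fin k]→ₗ[A] A)
    (hη : d η ∈ relForms S (k + 1)) (hθ : d θ ∈ relForms S (k + 1))
    (h : restrict S k η - restrict S k θ ∈ coboundaries A S A k) :
    cls (conormalPart S k ⟨d η, hη⟩) (d_conormalPart_d S η hη) =
      cls (conormalPart S k ⟨d θ, hθ⟩) (d_conormalPart_d S θ hθ) := by
  refine cls_eq _ _ ?_
  have hd : d (η - θ) ∈ relForms S (k + 1) := by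
    rw [map_sub]
    exact sub_mem hη hθ
  have h₁ := conormalPart_d_mem S (η - θ) (by rwa [map_sub]) hd hS
  refine Eq.mp (congrArg (· ∈ _) ?_) h₁
  refine Eq.trans ?_ (map_sub (conormalPart S k) _ _)
  exact congrArg _ (Subtype.ext (map_sub d _ _))

/-- The transverse differentiation map `[α] ↦ [p (d α̃)]`, where `α̃` is any extension of the closed
form `α` (by `dnu_cls` the class does not depend on it). -/
def dnu (S : LieRinehartSubalgebra A L) (hS : ∀ n, Function.Surjective (restrict S n)) (k : ℕ) :
    Cohomology A S A k →ₗ[ℝ] Cohomology A S (Conormal S) k :=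
  have hr (α : S [⋀^Fin k]→ₗ[A] A) : restrict S k (hS k α).choose = α := (hS k α).choose_spec
  have hm (α : cocycles A S A k) : d (hS k α).choose ∈ relForms S (k + 1) :=
    d_extension_mem S _ (by rw [hr]; exact α.2)
  Submodule.liftQ _
    { toFun := fun α => cls (conormalPart S k ⟨d (hS k α).choose, hm α⟩) (d_conormalPart_d S _ _)
      map_add' := fun α β => by
        have hs : d ((hS k α).choose + (hS k β).choose) ∈ relForms S (k + 1) := by
          rw [map_add]
          exact add_mem (hm α) (hm β)
        rw [cls_conormalPart_eq S hS _ ((hS k α).choose + (hS k β).choose) _ hs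
          (by rw [map_add, hr, hr, hr]; simp)]
        refine cls_add _ _ _ (Eq.trans ?_ (map_add (conormalPart S k) _ _))
        exact congrArg _ (Subtype.ext (by simp))
      map_smul' := fun c α => by
        have hs : d (c • (hS k α).choose) ∈ relForms S (k + 1) := by
          rw [map_smul]
          exact (relForms S (k + 1)).smul_mem c (hm α)
        rw [cls_conormalPart_eq S hS _ (c • (hS k α).choose) _ hs
          (by rw [map_smul, hr, hr]; simp)]
        refine cls_smul _ _ c (Eq.trans ?_ (map_smul (conormalPart S k) _ _))
        exact congrArg _ (Subtype.ext (by simp)) }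
    (by
      intro α hα
      refine LinearMap.mem_ker.2 (cls_eq_zero (d_conormalPart_d S _ (hm α)) ?_)
      refine conormalPart_d_mem S _ ?_ (hm α) hS
      rw [hr]
      exact hα)

theorem dnu_cls (S : LieRinehartSubalgebra A L) (hS : ∀ n, Function.Surjective (restrict S n))
    {k : ℕ} (η : L [⋀^Fin k]→ₗ[A] A) (h : d (restrict S k η) = 0) :
    dnu S hS k (cls (restrict S k η) h) =
      cls (conormalPart S k ⟨d η, d_extension_mem S η h⟩) (d_conormalPart_d S η _) := by
  refine cls_conormalPart_eq S hS _ η _ _ ?_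
  rw [(hS k _).choose_spec, sub_self]
  exact zero_mem _

/-- A complement of the subalgebra. -/
structure Complement (S : LieRinehartSubalgebra A L) where
  /-- the underlying submodule -/
  carrier : Submodule A L
  isCompl : IsCompl S.toSubmodule carrier

namespace Complement

variable {S : LieRinehartSubalgebra A L} (G : Complement S)

/-- The projection onto `S` along `G`. -/
def prS : L →ₗ[A] S := S.toSubmodule.projectionOnto G.carrier G.isCompl

/-- The projection onto `G` along `S`. -/
def prG : L →ₗ[A] G.carrier := G.carrier.projectionOnto S.toSubmodule G.isCompl.symm

theorem prS_coe (x : S) : G.prS x = x := Submodule.projectionOnto_apply_left G.isCompl x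

theorem prG_coe (y : G.carrier) : G.prG y = y :=
  Submodule.projectionOnto_apply_left G.isCompl.symm y

theorem prG_eq_zero {y : L} (hy : y ∈ S) : G.prG y = 0 :=
  (Submodule.projectionOnto_apply_eq_zero_iff G.isCompl.symm).2 hy

theorem prG_add_prS (y : L) : (G.prG y : L) + G.prS y = y :=
  Submodule.projection_add_projection_eq_self G.isCompl.symm y

theorem restrict_surjective (G : Complement S) (n : ℕ) : Function.Surjective (restrict S n) := fun α =>
  ⟨extend G.prS n α, restrict_extend G.prS G.prS_coe n α⟩

theorem prG_lie_prG (x : S) (y : L) : G.prG ⁅(x : L), (G.prG y : L)⁆ = G.prG ⁅(x : L), y⁆ := by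
  conv_rhs => rw [← G.prG_add_prS y, lie_add, map_add,
    G.prG_eq_zero (S.lie_mem x.2 (G.prS y).2), add_zero]

/-- The Bott connection `∇_x y = pr_G [x, y]` on a complement. -/
instance : LieRingModule S G.carrier where
  bracket x y := G.prG ⁅(x : L), (y : L)⁆
  add_lie x y z := (congrArg G.prG (add_lie (x : L) y (z : L))).trans (map_add _ _ _)
  lie_add x y z := (congrArg G.prG (lie_add (x : L) (y : L) z)).trans (map_add _ _ _)
  leibniz_lie x y z := by
    change G.prG ⁅(x : L), (G.prG ⁅(y : L), (z : L)⁆ : L)⁆ = G.prG ⁅⁅(x : L), (y : L)⁆, (z : L)⁆ +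
      G.prG ⁅(y : L), (G.prG ⁅(x : L), (z : L)⁆ : L)⁆
    rw [prG_lie_prG, prG_lie_prG, ← map_add, leibniz_lie (x : L) (y : L) (z : L)]

theorem lie_def (x : S) (y : G.carrier) : ⁅x, y⁆ = G.prG ⁅(x : L), (y : L)⁆ := rfl

instance : LieModule ℝ S G.carrier where
  smul_lie c x y := (congrArg G.prG (smul_lie c (x : L) (y : L))).trans
    (LinearMap.map_smul_of_tower G.prG c _)
  lie_smul c x y := (congrArg G.prG (lie_smul c (x : L) (y : L))).trans
    (LinearMap.map_smul_of_tower G.prG c _)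

instance : FlatModule A S G.carrier where
  smul_lie' a x y := by
    have h : ⁅a • (x : L), (y : L)⁆ = a • ⁅(x : L), (y : L)⁆ - ⁅(y : L), a⁆ • (x : L) := by
      rw [← lie_skew, LieRinehartRing.leibniz_smul_right, neg_add, ← smul_neg, lie_skew,
        sub_eq_add_neg]
    change G.prG ⁅a • (x : L), (y : L)⁆ = a • G.prG ⁅(x : L), (y : L)⁆
    rw [h, map_sub, map_smul, G.prG_eq_zero (S.smul_mem _ x.2), sub_zero]
  lie_smul' x a y := by
    change G.prG ⁅(x : L), a • (y : L)⁆ = a • G.prG ⁅(x : L), (y : L)⁆ + ⁅(x : L), a⁆ • y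
    rw [LieRinehartRing.leibniz_smul_right, map_add, map_smul, map_smul, prG_coe]

/-- The identification of a complement with the normal module. -/
def toNormal : G.carrier →ₗ[A] Normal S := LieForms.toNormal S ∘ₗ G.carrier.subtype

theorem toNormal_lie (x : S) (y : G.carrier) : G.toNormal ⁅x, y⁆ = ⁅x, G.toNormal y⁆ := by
  change LieForms.toNormal S (G.prG ⁅(x : L), (y : L)⁆) = LieForms.toNormal S ⁅(x : L), (y : L)⁆
  conv_rhs => rw [← G.prG_add_prS ⁅(x : L), (y : L)⁆, map_add]
  rw [left_eq_add]
  exact (Submodule.Quotient.mk_eq_zero _).2 (G.prS _).2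

/-- The identification of the cohomologies with coefficients in a complement and in the normal
module. -/
def cohNormal (k : ℕ) : Cohomology A S G.carrier k →ₗ[ℝ] Cohomology A S (Normal S) k :=
  cohMap (mapCoeff G.toNormal) (Or.inl (mapCoeff_d G.toNormal G.toNormal_lie)) k

end Complement

/-- The contraction `y ↦ ω (x, y)` of a two-form. -/
def contract (ω : L [⋀^Fin 2]→ₗ[A] A) : L →ₗ[A] Module.Dual A L :=
  LinearMap.mk₂ A (fun x y => ω ![x, y]) (fun _ _ _ => ω.map_vecCons_add _ _ _)
    (fun _ _ _ => ω.map_vecCons_smul _ _ _)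
    (fun x _ _ => (ω.curryLeft x).map_vecCons_add _ _ _)
    (fun _ x _ => (ω.curryLeft x).map_vecCons_smul _ _ _)

theorem contract_apply (ω : L [⋀^Fin 2]→ₗ[A] A) (x y : L) : contract ω x y = ω ![x, y] := rfl

theorem contract_swap (ω : L [⋀^Fin 2]→ₗ[A] A) (x y : L) : ω ![x, y] = -ω ![y, x] :=
  map_vecCons_swap ω x y _

/-- `ω` is closed, has `S` as its kernel, and every functional that vanishes on `S` is of the form
`ω (z, ·)`. -/
structure IsTransverselySymplectic (ω : L [⋀^Fin 2]→ₗ[A] A) (S : LieRinehartSubalgebra A L) :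
    Prop where
  closed : d ω = 0
  mem_iff : ∀ x, x ∈ S ↔ ∀ y, ω ![x, y] = 0
  exists_eq : ∀ l : Module.Dual A L, (∀ x ∈ S, l x = 0) → ∃ z, ∀ y, ω ![z, y] = l y

namespace IsTransverselySymplectic

variable {ω : L [⋀^Fin 2]→ₗ[A] A} {S : LieRinehartSubalgebra A L}

/-- The map `ω♭ : x̄ ↦ ω (x, ·)` from the normal to the conormal module. -/
def flat (hω : IsTransverselySymplectic ω S) : Normal S →ₗ[A] Conormal S :=
  S.toSubmodule.liftQ
    { toFun := fun x => S.toSubmodule.liftQ (contract ω x) (fun y hy => by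
        change ω ![x, y] = 0
        rw [contract_swap, (hω.mem_iff y).1 hy x, neg_zero])
      map_add' := fun x y => by ext z; exact LinearMap.congr_fun (map_add (contract ω) x y) z
      map_smul' := fun a x => by ext z; exact LinearMap.congr_fun (map_smul (contract ω) a x) z }
    (fun x hx => by ext y; exact (hω.mem_iff x).1 hx y)

theorem flat_apply (hω : IsTransverselySymplectic ω S) (x y : L) :
    hω.flat (toNormal S x) (toNormal S y) = ω ![x, y] := rfl

theorem flat_bijective (hω : IsTransverselySymplectic ω S) : Function.Bijective hω.flat := by
  constructor
  · refine (injective_iff_map_eq_zero _).2 fun n hn => ?_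
    obtain ⟨x, rfl⟩ := Submodule.mkQ_surjective _ n
    refine (Submodule.Quotient.mk_eq_zero _).2 ?_
    exact (hω.mem_iff x).2 fun y => LinearMap.congr_fun hn (toNormal S y)
  · intro β
    obtain ⟨z, hz⟩ := hω.exists_eq (β ∘ₗ toNormal S) (fun x hx => by
      have : toNormal S x = 0 := (Submodule.Quotient.mk_eq_zero _).2 hx
      rw [LinearMap.comp_apply, this, map_zero])
    exact ⟨toNormal S z, by ext y; exact hz y⟩

theorem flat_lie (hω : IsTransverselySymplectic ω S) (x : S) (n : Normal S) :
    hω.flat ⁅x, n⁆ = ⁅x, hω.flat n⁆ := by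
  obtain ⟨y, rfl⟩ := Submodule.mkQ_surjective _ n
  ext z
  change ω ![⁅(x : L), y⁆, z] = ⁅(x : L), ω ![y, z]⁆ - ω ![y, ⁅(x : L), z⁆]
  have h := congrArg (fun f => f ![(x : L), y, z]) hω.closed
  have hx : ins (x : L) ω = 0 := by
    refine AlternatingMap.ext fun V => ?_
    have := (hω.mem_iff x).1 x.2 (V 0)
    rw [ins_apply, AlternatingMap.zero_apply, ← this]
    congr 1
    funext i
    fin_cases i <;> rfl
  have h' : ins (x : L) (d ω) ![y, z] = 0 := h
  rw [ins_d_succ, hx, map_zero, sub_zero, lieD_succ_apply] at h'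
  simp only [Nat.reduceAdd, Fin.sum_univ_two, Fin.val_zero, pow_zero, one_smul, Fin.val_one, pow_one,
    neg_smul] at h'
  have e₀ : ω (Matrix.vecCons ⁅(x : L), ![y, z] 0⁆ (Fin.removeNth 0 ![y, z])) =
      ω ![⁅(x : L), y⁆, z] := by
    congr 1
  have e₁ : ω (Matrix.vecCons ⁅(x : L), ![y, z] 1⁆ (Fin.removeNth 1 ![y, z])) =
      ω ![⁅(x : L), z⁆, y] := by
    congr 1; funext i; fin_cases i <;> rfl
  rw [e₀, e₁] at h'
  rw [contract_swap ω y ⁅(x : L), z⁆]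
  linear_combination -h'

/-- The isomorphism `ω♭` from the normal to the conormal module. -/
def flatEquiv (hω : IsTransverselySymplectic ω S) : Normal S ≃ₗ[A] Conormal S :=
  LinearEquiv.ofBijective hω.flat hω.flat_bijective

theorem flatEquiv_symm_lie (hω : IsTransverselySymplectic ω S) (x : S) (β : Conormal S) :
    hω.flatEquiv.symm ⁅x, β⁆ = ⁅x, hω.flatEquiv.symm β⁆ := by
  rw [LinearEquiv.symm_apply_eq]
  refine Eq.trans ?_ (hω.flat_lie x _).symm
  exact congrArg _ (hω.flatEquiv.apply_symm_apply β).symm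

/-- The map `[-Id ⊗ (ω♭)⁻¹]` in cohomology. -/
def cohNegFlatSymm (hω : IsTransverselySymplectic ω S) (k : ℕ) :
    Cohomology A S (Conormal S) k →ₗ[ℝ] Cohomology A S (Normal S) k :=
  cohMap (mapCoeff (-hω.flatEquiv.symm.toLinearMap))
    (Or.inl (mapCoeff_d _ fun x β => by
      rw [LinearMap.neg_apply, LinearMap.neg_apply, lie_neg]
      exact congrArg _ (hω.flatEquiv_symm_lie x β))) k

/-- The isomorphism `ω♭ : y ↦ ω (y, ·)` from a complement to its dual. -/
def flatG (hω : IsTransverselySymplectic ω S) (G : Complement S) :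
    G.carrier ≃ₗ[A] Module.Dual A G.carrier :=
  LinearEquiv.ofBijective
    ((contract ω).domRestrict₁₂ G.carrier G.carrier) (by
      constructor
      · refine (injective_iff_map_eq_zero _).2 fun y hy => ?_
        have hS : (y : L) ∈ S := (hω.mem_iff y).2 fun z => by
          rw [← G.prG_add_prS z]
          have h₁ : contract ω y (G.prG z) = 0 := LinearMap.congr_fun hy (G.prG z)
          have h₂ : contract ω y (G.prS z) = 0 := by
            rw [contract_apply, contract_swap, (hω.mem_iff _).1 (G.prS z).2, neg_zero]
          change contract ω y _ = 0
          rw [map_add, h₁, h₂, add_zero]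
        exact (G.prG_coe y).symm.trans (G.prG_eq_zero hS)
      · intro β
        obtain ⟨z, hz⟩ := hω.exists_eq (β ∘ₗ G.prG) (fun x hx => by
          rw [LinearMap.comp_apply, G.prG_eq_zero hx, map_zero])
        refine ⟨G.prG z, ?_⟩
        ext y
        have h := hz y
        rw [LinearMap.comp_apply, G.prG_coe] at h
        rw [← h]
        change contract ω (G.prG z) y = contract ω z y
        conv_rhs => rw [← G.prG_add_prS z, map_add, LinearMap.add_apply]
        rw [left_eq_add]
        exact (hω.mem_iff _).1 (G.prS z).2 _)

end IsTransverselySymplectic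

end Transverse
end LieForms

section Geometry

open scoped Manifold ContDiff Topology
open Set Filter Bundle

section VectorFields

variable {E : Type*} [NormedAddCommGroup E] [NormedSpace ℝ E] [FiniteDimensional ℝ E]
  {C : Type*} [TopologicalSpace C] [ChartedSpace E C] [IsManifold 𝓘(ℝ, E) ∞ C]

variable (E C) in
/-- The algebra of smooth functions on `C`. -/
abbrev SmoothFun : Type _ := C^∞⟮𝓘(ℝ, E), C; ℝ⟯

variable (E C) in
/-- The smooth vector fields on `C`. -/
abbrev VF : Type _ := Cₛ^∞⟮𝓘(ℝ, E); E, (TangentSpace 𝓘(ℝ, E) : C → Type _)⟯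

namespace VF

instance : Module (SmoothFun E C) (VF E C) where
  smul f X := ⟨fun x => f x • X x, f.contMDiff.smul_section X.contMDiff⟩
  one_smul X := ContMDiffSection.ext fun x => one_smul ℝ (X x)
  mul_smul f g X := ContMDiffSection.ext fun x => mul_smul (f x) (g x) (X x)
  smul_zero f := ContMDiffSection.ext fun x => smul_zero (f x)
  smul_add f X Y := ContMDiffSection.ext fun x => smul_add (f x) (X x) (Y x)
  add_smul f g X := ContMDiffSection.ext fun x => add_smul (f x) (g x) (X x)
  zero_smul X := ContMDiffSection.ext fun x => zero_smul ℝ (X x)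

theorem smul_apply (f : SmoothFun E C) (X : VF E C) (x : C) : (f • X) x = f x • X x := rfl

theorem add_apply (X Y : VF E C) (x : C) : (X + Y) x = X x + Y x := rfl

theorem sub_apply (X Y : VF E C) (x : C) : (X - Y) x = X x - Y x := rfl

instance : IsScalarTower ℝ (SmoothFun E C) (VF E C) where
  smul_assoc c f X := ContMDiffSection.ext fun x => smul_assoc c (f x) (X x)

theorem mdiff (X : VF E C) (x : C) :
    MDifferentiableAt 𝓘(ℝ, E) 𝓘(ℝ, E).tangent (fun y => (X y : TangentBundle 𝓘(ℝ, E) C)) x :=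
  X.mdifferentiableAt

theorem minSmoothness_le (k : ℕ) : minSmoothness ℝ (k : WithTop ℕ∞) ≤ (∞ : WithTop ℕ∞) := by
  rw [minSmoothness_of_isRCLikeNormedField]
  exact_mod_cast (le_top : ((k : ℕ∞)) ≤ ⊤)

instance (k : ℕ) : IsManifold 𝓘(ℝ, E) (minSmoothness ℝ (k : WithTop ℕ∞)) C :=
  IsManifold.of_le (n := ∞) (minSmoothness_le k)

/-- The Lie bracket of vector fields. -/
instance : Bracket (VF E C) (VF E C) where
  bracket X Y := ⟨VectorField.mlieBracket 𝓘(ℝ, E) X Y, fun x => by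
    have h2 : IsManifold 𝓘(ℝ, E) (minSmoothness ℝ 2) C :=
      inferInstanceAs (IsManifold 𝓘(ℝ, E) (minSmoothness ℝ ((2 : ℕ) : WithTop ℕ∞)) C)
    have h1 : IsManifold 𝓘(ℝ, E) (((⊤ : ℕ∞) : WithTop ℕ∞) + 1) C :=
      inferInstanceAs (IsManifold 𝓘(ℝ, E) ∞ C)
    exact ContMDiffAt.mlieBracket_vectorField (m := ⊤) (n := ⊤) (X.contMDiff x) (Y.contMDiff x)
      (by simp)⟩

theorem bracket_coe (X Y : VF E C) : ⇑⁅X, Y⁆ = VectorField.mlieBracket 𝓘(ℝ, E) X Y := rfl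

theorem bracket_apply (X Y : VF E C) (x : C) :
    ⁅X, Y⁆ x = VectorField.mlieBracket 𝓘(ℝ, E) X Y x := rfl

instance : LieRing (VF E C) where
  add_lie X Y Z := ContMDiffSection.ext fun x =>
    VectorField.mlieBracket_add_left (X.mdiff x) (Y.mdiff x)
  lie_add X Y Z := ContMDiffSection.ext fun x =>
    VectorField.mlieBracket_add_right (Y.mdiff x) (Z.mdiff x)
  lie_self X := ContMDiffSection.ext fun x =>
    congrFun VectorField.mlieBracket_self x
  leibniz_lie X Y Z := by
    have h2 := minSmoothness_le 2
    have h3 : IsManifold 𝓘(ℝ, E) (minSmoothness ℝ 3) C :=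
      inferInstanceAs (IsManifold 𝓘(ℝ, E) (minSmoothness ℝ ((3 : ℕ) : WithTop ℕ∞)) C)
    exact ContMDiffSection.ext fun x => VectorField.leibniz_identity_mlieBracket_apply
      ((X.contMDiff x).of_le h2) ((Y.contMDiff x).of_le h2) ((Z.contMDiff x).of_le h2)

instance : LieAlgebra ℝ (VF E C) where
  lie_smul _ _ Y := ContMDiffSection.ext fun x =>
    VectorField.mlieBracket_const_smul_right (Y.mdiff x)

/-- The derivative `X f` of a function along a vector field. -/
instance : Bracket (VF E C) (SmoothFun E C) where
  bracket X f := ⟨fun x => mvfderiv 𝓘(ℝ, E) f x (X x), by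
    have h := (f.contMDiff.contMDiff_tangentMap (m := ∞) (by simp)).comp X.contMDiff
    exact (contMDiff_snd_tangentBundle_modelSpace ℝ 𝓘(ℝ, ℝ)).comp h⟩

theorem lie_apply (X : VF E C) (f : SmoothFun E C) (x : C) :
    ⁅X, f⁆ x = mvfderiv 𝓘(ℝ, E) f x (X x) := rfl

theorem lie_smul_right (X Y : VF E C) (f : SmoothFun E C) : ⁅X, f • Y⁆ = f • ⁅X, Y⁆ + ⁅X, f⁆ • Y :=
  ContMDiffSection.ext fun x => (VectorField.mlieBracket_smul_right f.mdifferentiableAt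
    (Y.mdiff x)).trans (add_comm _ _)

end VF
end VectorFields

section LocalTools

variable {E : Type*} [NormedAddCommGroup E] [NormedSpace ℝ E] [FiniteDimensional ℝ E]
  {C : Type*} [TopologicalSpace C] [ChartedSpace E C] [IsManifold 𝓘(ℝ, E) ∞ C] [T2Space C]

namespace VF

theorem exists_bump {x : C} {U : Set C} (hU : U ∈ 𝓝 x) :
    ∃ χ : SmoothFun E C, tsupport χ ⊆ U ∧ χ =ᶠ[𝓝 x] 1 := by
  obtain ⟨f, -, hf⟩ := (SmoothBumpFunction.nhds_basis_tsupport (I := 𝓘(ℝ, E)) x).mem_iff.1 hU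
  exact ⟨⟨f, f.contMDiff⟩, hf, f.eventuallyEq_one⟩

/-- A bump function times a local section is a global section. -/
theorem exists_global {U : Set C} (hU : IsOpen U) {χ : SmoothFun E C}
    (hχ : tsupport χ ⊆ U) {s : Π y : C, TangentSpace 𝓘(ℝ, E) y}
    (hs : ContMDiffOn 𝓘(ℝ, E) 𝓘(ℝ, E).tangent ∞ (fun y => (s y : TangentBundle 𝓘(ℝ, E) C)) U) :
    ∃ S : VF E C, ∀ y, S y = χ y • s y :=
  ⟨⟨fun y => χ y • s y, ContMDiffOn.smul_section_of_tsupport χ.contMDiff.contMDiffOn hU hχ hs⟩,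
    fun _ => rfl⟩

theorem exists_global_fun {U : Set C} (hU : IsOpen U) {χ : SmoothFun E C}
    (hχ : tsupport χ ⊆ U) {s : C → ℝ} (hs : ContMDiffOn 𝓘(ℝ, E) 𝓘(ℝ, ℝ) ∞ s U) :
    ∃ S : SmoothFun E C, ∀ y, S y = χ y * s y := by
  refine ⟨⟨fun y => χ y * s y, contMDiff_of_tsupport fun y hy => ?_⟩, fun _ => rfl⟩
  have hy' : y ∈ U := hχ (tsupport_mul_subset_left hy)
  exact (χ.contMDiff y).mul ((hs y hy').contMDiffAt (hU.mem_nhds hy'))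

/-- Every tangent vector extends to a vector field. -/
theorem exists_extend (x : C) (v : TangentSpace 𝓘(ℝ, E) x) : ∃ X : VF E C, X x = v := by
  obtain ⟨U, hU, h⟩ := FiberBundle.exists_contMDiffOn_extend (k := ∞) 𝓘(ℝ, E) E v
  obtain ⟨V, hVU, hV, hx⟩ := mem_nhds_iff.1 hU
  obtain ⟨χ, hχ, h1⟩ := exists_bump (E := E) (hV.mem_nhds hx)
  obtain ⟨S, hS⟩ := exists_global hV hχ (h.mono hVU)
  refine ⟨S, ?_⟩
  rw [hS, h1.eq_of_nhds]
  simp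

/-- A smooth family of linear maps that is bijective at a point is bijective nearby, and the
inverse is smooth. -/
theorem eventually_inverse {V W : Type*} [NormedAddCommGroup V] [NormedSpace ℝ V]
    [FiniteDimensional ℝ V] [NormedAddCommGroup W] [NormedSpace ℝ W] [FiniteDimensional ℝ W]
    {x : C} (T : C → V →L[ℝ] W)
    (hT : ∀ᶠ y in 𝓝 x, ContMDiffAt 𝓘(ℝ, E) 𝓘(ℝ, V →L[ℝ] W) ∞ T y)
    (hx : Function.Bijective (T x)) :
    ∀ᶠ y in 𝓝 x, Function.Bijective (T y) ∧
      ContMDiffAt 𝓘(ℝ, E) 𝓘(ℝ, W →L[ℝ] V) ∞ (fun y => (T y).inverse) y := by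
  have : CompleteSpace V := FiniteDimensional.complete ℝ V
  let e : V ≃L[ℝ] W := (LinearEquiv.ofBijective (T x).toLinearMap hx).toContinuousLinearEquiv
  have he : (e : V →L[ℝ] W) = T x := by ext; rfl
  have h := (hT.self_of_nhds).continuousAt.eventually (he ▸ e.nhds)
  filter_upwards [h, hT] with y ⟨f, hf⟩ hy
  refine ⟨hf ▸ f.bijective, ?_⟩
  have hinv : ContDiffAt ℝ ∞ ContinuousLinearMap.inverse (T y) := hf ▸ contDiffAt_map_inverse f
  exact hinv.contMDiffAt.comp y hy

theorem inverse_apply_eq {V W : Type*} [NormedAddCommGroup V] [NormedSpace ℝ V]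
    [FiniteDimensional ℝ V] [NormedAddCommGroup W] [NormedSpace ℝ W]
    (T : V →L[ℝ] W) (hT : Function.Bijective T) (w : W) : T (T.inverse w) = w := by
  let e : V ≃L[ℝ] W := (LinearEquiv.ofBijective T.toLinearMap hT).toContinuousLinearEquiv
  have he : (e : V →L[ℝ] W) = T := by ext; rfl
  rw [← he, ContinuousLinearMap.inverse_equiv]
  exact e.apply_symm_apply w

/-- Vector fields that form a basis at a point do so nearby, and the components of every vector
field are smooth. -/
theorem eventually_basis {ι : Type*} [Fintype ι] (u : ι → VF E C) {x : C}
    (hli : LinearIndependent ℝ fun i => u i x) (hsp : Submodule.span ℝ (range fun i => u i x) = ⊤) :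
    (∀ᶠ y in 𝓝 x, LinearIndependent ℝ (fun i => u i y) ∧
      Submodule.span ℝ (range fun i => u i y) = ⊤) ∧
    ∀ Y : VF E C, ∃ c : ι → C → ℝ, ∀ᶠ y in 𝓝 x, Y y = ∑ i, c i y • u i y ∧
      ∀ i, ContMDiffAt 𝓘(ℝ, E) 𝓘(ℝ, ℝ) ∞ (c i) y := by
  let e := trivializationAt E (TangentSpace 𝓘(ℝ, E) : C → Type _) x
  have hxe : x ∈ e.baseSet := FiberBundle.mem_baseSet_trivializationAt' x
  let T : C → (ι → ℝ) →L[ℝ] E := fun y =>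
    ∑ i, (ContinuousLinearMap.proj i : (ι → ℝ) →L[ℝ] ℝ).smulRight (e ⟨y, u i y⟩).2
  have hsm (Y : VF E C) {y : C} (hy : y ∈ e.baseSet) :
      ContMDiffAt 𝓘(ℝ, E) 𝓘(ℝ, E) ∞ (fun z => (e ⟨z, Y z⟩).2) y :=
    (e.contMDiffAt_section_iff hy).1 (Y.contMDiff y)
  have hT : ∀ᶠ y in 𝓝 x, ContMDiffAt 𝓘(ℝ, E) 𝓘(ℝ, (ι → ℝ) →L[ℝ] E) ∞ T y := by
    filter_upwards [e.open_baseSet.mem_nhds hxe] with y hy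
    refine ContMDiffAt.sum fun i _ => ?_
    have : ContMDiff 𝓘(ℝ, E) 𝓘(ℝ, (ι → ℝ) →L[ℝ] E) ∞
        (ContinuousLinearMap.smulRightL ℝ (ι → ℝ) E
          (ContinuousLinearMap.proj i : (ι → ℝ) →L[ℝ] ℝ)) := ContinuousLinearMap.contMDiff _
    exact this.contMDiffAt.comp y (hsm (u i) hy)
  have hTe {y : C} (hy : y ∈ e.baseSet) (c : ι → ℝ) :
      T y c = e.linearEquivAt ℝ y hy (∑ i, c i • u i y) := by
    simp [T, map_sum]
  have hbij {y : C} (hy : y ∈ e.baseSet) : Function.Bijective (T y) ↔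
      LinearIndependent ℝ (fun i => u i y) ∧ Submodule.span ℝ (range fun i => u i y) = ⊤ := by
    have h1 : (T y : (ι → ℝ) → E) = e.linearEquivAt ℝ y hy ∘ Fintype.linearCombination ℝ
        (fun i => u i y) := by
      funext c
      rw [hTe hy]
      rfl
    rw [h1, (e.linearEquivAt ℝ y hy).bijective.of_comp_iff', Function.Bijective,
      linearIndependent_iff_injective_fintypeLinearCombination, ← LinearMap.range_eq_top,
      Fintype.range_linearCombination]
  have hev := eventually_inverse T hT ((hbij hxe).2 ⟨hli, hsp⟩)
  refine ⟨?_, fun Y => ⟨fun i y => (T y).inverse (e ⟨y, Y y⟩).2 i, ?_⟩⟩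
  · filter_upwards [hev, e.open_baseSet.mem_nhds hxe] with y h hy
    exact (hbij hy).1 h.1
  · filter_upwards [hev, e.open_baseSet.mem_nhds hxe] with y h hy
    constructor
    · have h2 := inverse_apply_eq (T y) h.1 (e ⟨y, Y y⟩).2
      rw [hTe hy] at h2
      refine ((e.linearEquivAt ℝ y hy).injective (h2.trans ?_)).symm
      simp
    · intro i
      have h3 := h.2.clm_apply (hsm Y hy)
      exact contMDiffAt_pi_space.1 h3 i

end VF
end LocalTools

section LieRinehart

variable {E : Type*} [NormedAddCommGroup E] [NormedSpace ℝ E] [FiniteDimensional ℝ E]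
  {C : Type*} [TopologicalSpace C] [ChartedSpace E C] [IsManifold 𝓘(ℝ, E) ∞ C] [T2Space C]

namespace VF

theorem lie_lie_fun (X Y : VF E C) (f : SmoothFun E C) : ⁅⁅X, Y⁆, f⁆ = ⁅X, ⁅Y, f⁆⁆ - ⁅Y, ⁅X, f⁆⁆ := by
  ext x
  by_cases hE : ∃ v : TangentSpace 𝓘(ℝ, E) x, v ≠ 0
  · obtain ⟨v, hv⟩ := hE
    obtain ⟨Z, rfl⟩ := exists_extend x v
    have h := leibniz_lie X Y (f • Z)
    rw [lie_smul_right Y Z, lie_smul_right X Z, lie_smul_right, lie_add, lie_add, lie_smul_right,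
      lie_smul_right, lie_smul_right, lie_smul_right, leibniz_lie X Y Z, smul_add] at h
    have h' : ⁅X, ⁅Y, f⁆⁆ • Z = ⁅⁅X, Y⁆, f⁆ • Z + ⁅Y, ⁅X, f⁆⁆ • Z := by
      rw [← sub_eq_zero] at h ⊢
      rw [← h]
      abel
    have h2 := congrArg (fun W : VF E C => W x) h'
    simp only [smul_apply, ← add_smul] at h2
    have h3 := smul_left_injective ℝ hv h2
    have h4 : ⁅X, ⁅Y, f⁆⁆ x = ⁅⁅X, Y⁆, f⁆ x + ⁅Y, ⁅X, f⁆⁆ x := h3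
    exact eq_sub_of_add_eq h4.symm
  · push Not at hE
    change ⁅⁅X, Y⁆, f⁆ x = ⁅X, ⁅Y, f⁆⁆ x - ⁅Y, ⁅X, f⁆⁆ x
    rw [lie_apply, lie_apply, lie_apply, hE (⁅X, Y⁆ x), hE (X x), hE (Y x)]
    simp

instance : LieRingModule (VF E C) (SmoothFun E C) where
  add_lie X Y f := ContMDiffMap.ext fun x => map_add (mvfderiv 𝓘(ℝ, E) f x) (X x) (Y x)
  lie_add X f g := ContMDiffMap.ext fun x => DFunLike.congr_fun
    (mvfderiv_add f.mdifferentiableAt g.mdifferentiableAt) (X x)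
  leibniz_lie X Y f := by rw [lie_lie_fun, sub_add_cancel]

instance : LieRinehartRing (SmoothFun E C) (VF E C) where
  lie_smul_eq_mul' f g X := ContMDiffMap.ext fun x =>
    map_smul (mvfderiv 𝓘(ℝ, E) g x) (f x) (X x)
  leibniz_mul_right' X f g := ContMDiffMap.ext fun x => by
    refine (DFunLike.congr_fun (mvfderiv_mul f.mdifferentiableAt g.mdifferentiableAt) (X x)).trans ?_
    change f x * mvfderiv 𝓘(ℝ, E) g x (X x) + g x * mvfderiv 𝓘(ℝ, E) f x (X x) =
      f x * mvfderiv 𝓘(ℝ, E) g x (X x) + mvfderiv 𝓘(ℝ, E) f x (X x) * g x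
    ring
  leibniz_smul_right' X Y f := lie_smul_right X Y f

instance : LieRinehartAlgebra ℝ (SmoothFun E C) (VF E C) where
  smul_assoc := smul_assoc
  smul_lie c X f := ContMDiffMap.ext fun x => map_smul (mvfderiv 𝓘(ℝ, E) f x) c (X x)
  lie_smul c X f := ContMDiffMap.ext fun x => by
    have h := DFunLike.congr_fun (mvfderiv_smul (I := 𝓘(ℝ, E)) (x := x) (a := fun _ => c)
      mdifferentiableAt_const f.mdifferentiableAt) (X x)
    rw [mvfderiv_const] at h
    refine h.trans ?_
    change c * mvfderiv 𝓘(ℝ, E) f x (X x) + 0 * f x = c * mvfderiv 𝓘(ℝ, E) f x (X x)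
    rw [zero_mul, add_zero]

/-- Functionals on vector fields are tensorial. -/
theorem tensorial (l : Module.Dual (SmoothFun E C) (VF E C)) {Y Z : VF E C} {x : C}
    (h : Y x = Z x) : l Y x = l Z x := by
  suffices H : ∀ Y : VF E C, Y x = 0 → l Y x = 0 by
    have := H (Y - Z) (by rw [sub_apply, h, sub_self])
    rw [map_sub] at this
    exact sub_eq_zero.1 this
  intro Y hY
  have : FiniteDimensional ℝ (TangentSpace 𝓘(ℝ, E) x) := inferInstanceAs (FiniteDimensional ℝ E)
  let b := Module.finBasis ℝ (TangentSpace 𝓘(ℝ, E) x)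
  choose u hu using fun i => exists_extend x (b i)
  have hb : (fun i => u i x) = b := funext hu
  obtain ⟨c, hc⟩ := (eventually_basis u (x := x) (hb ▸ b.linearIndependent)
    (hb ▸ b.span_eq)).2 Y
  obtain ⟨U, hUs, hU, hxU⟩ := eventually_nhds_iff.1 hc
  obtain ⟨χ, hχ, h1⟩ := exists_bump (E := E) (hU.mem_nhds hxU)
  choose s hs using fun i => exists_global_fun hU hχ (s := c i)
    (fun y hy => ((hUs y hy).2 i).contMDiffWithinAt)
  have hY' : χ • Y = ∑ i, s i • u i := by
    refine ContMDiffSection.ext fun y => ?_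
    have hsum : (∑ i, s i • u i) y = ∑ i, s i y • u i y := by
      have := map_sum (ContMDiffSection.coeAddHom 𝓘(ℝ, E) E ∞
        (TangentSpace 𝓘(ℝ, E) : C → Type _)) (fun i => s i • u i) Finset.univ
      exact (congrFun this y).trans (Finset.sum_apply _ _ _)
    rw [hsum, smul_apply]
    by_cases hy : y ∈ U
    · rw [(hUs y hy).1, Finset.smul_sum]
      exact Finset.sum_congr rfl fun i _ => by rw [hs, mul_smul]
    · have hz : χ y = 0 := image_eq_zero_of_notMem_tsupport fun h' => hy (hχ h')
      simp [hs, hz]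
  have hc0 : ∀ i, c i x = 0 := by
    have h0 := (hUs x hxU).1
    rw [hY] at h0
    have hli : LinearIndependent ℝ fun i => u i x := hb ▸ b.linearIndependent
    exact Fintype.linearIndependent_iff.1 hli _ h0.symm
  have hl := congrArg (fun f : SmoothFun E C => f x) (congrArg l hY')
  simp only [map_smul, map_sum] at hl
  change χ x * l Y x = _ at hl
  have hev : (∑ i, s i • l (u i)) x = ∑ i, s i x * l (u i) x := by
    have := map_sum (ContMDiffMap.coeFnAddMonoidHom (I := 𝓘(ℝ, E)) (N := C) (G := ℝ) (n := ∞))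
      (fun i => s i • l (u i)) Finset.univ
    exact (congrFun this x).trans (Finset.sum_apply _ _ _)
  rw [hev, h1.eq_of_nhds] at hl
  simpa [hs, hc0] using hl

end VF
end LieRinehart

section Foliations

variable {E : Type*} [NormedAddCommGroup E] [NormedSpace ℝ E] [FiniteDimensional ℝ E]
  {C : Type*} [TopologicalSpace C] [ChartedSpace E C] [IsManifold 𝓘(ℝ, E) ∞ C] [T2Space C]

namespace VF

theorem span_sum_elim {V : Type*} [AddCommGroup V] [Module ℝ V] {ι κ : Type*} {u : ι → V}
    {w : κ → V} : Submodule.span ℝ (range (Sum.elim u w)) =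
      Submodule.span ℝ (range u) ⊔ Submodule.span ℝ (range w) := by
  rw [Sum.elim_range, Submodule.span_union]

theorem sum_apply {n : Type*} [Fintype n] (w : n → VF E C) (x : C) :
    (∑ i, w i) x = ∑ i, w i x := by
  have := map_sum (ContMDiffSection.coeAddHom 𝓘(ℝ, E) E ∞
    (TangentSpace 𝓘(ℝ, E) : C → Type _)) w Finset.univ
  exact (congrFun this x).trans (Finset.sum_apply _ _ _)

theorem map_sum_apply {n : Type*} [Fintype n] (l : Module.Dual (SmoothFun E C) (VF E C))
    (c : n → ℝ) (w : n → VF E C) (x : C) : l (∑ i, c i • w i) x = ∑ i, c i * l (w i) x := by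
  have h : l (∑ i, c i • w i) = ∑ i, c i • l (w i) := by
    rw [map_sum]
    exact Finset.sum_congr rfl fun i _ => LinearMap.map_smul_of_tower l (c i) (w i)
  have := map_sum (ContMDiffMap.coeFnAddMonoidHom (I := 𝓘(ℝ, E)) (N := C) (G := ℝ) (n := ∞))
    (fun i => c i • l (w i)) Finset.univ
  rw [h]
  exact (congrFun this x).trans (Finset.sum_apply _ _ _)

theorem dual_ext {n : Type*} [Fintype n] {u : n → VF E C} {x : C}
    (hu : Submodule.span ℝ (range fun i => u i x) = ⊤)
    (l l' : Module.Dual (SmoothFun E C) (VF E C)) (h : ∀ i, l (u i) x = l' (u i) x) (Y : VF E C) :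
    l Y x = l' Y x := by
  obtain ⟨c, hc⟩ := (Submodule.mem_span_range_iff_exists_fun ℝ).1
    (hu ▸ Submodule.mem_top : Y x ∈ Submodule.span ℝ (range fun i => u i x))
  have hY : Y x = (∑ i, c i • u i) x := by
    rw [sum_apply, ← hc]
    rfl
  rw [tensorial l hY, tensorial l' hY, map_sum_apply, map_sum_apply]
  exact Finset.sum_congr rfl fun i _ => by rw [h]

end VF

variable (E C) in
/-- A regular distribution on `C`, i.e. a smooth subbundle of the tangent bundle: near every point
its fibres are spanned by a smooth frame. -/
structure SmoothDistribution where
  /-- the fibre at a point -/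
  fiber (x : C) : Submodule ℝ (TangentSpace 𝓘(ℝ, E) x)
  exists_frame (x : C) : ∃ (r : ℕ) (s : Fin r → Π y : C, TangentSpace 𝓘(ℝ, E) y) (U : Set C),
    IsOpen U ∧ x ∈ U ∧
    (∀ i, ContMDiffOn 𝓘(ℝ, E) 𝓘(ℝ, E).tangent ∞ (fun y => (s i y : TangentBundle 𝓘(ℝ, E) C)) U) ∧
    ∀ y ∈ U, LinearIndependent ℝ (fun i => s i y) ∧
      Submodule.span ℝ (range fun i => s i y) = fiber y

namespace SmoothDistribution

/-- The module of sections of a distribution. -/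
def sections (D : SmoothDistribution E C) : Submodule (SmoothFun E C) (VF E C) where
  carrier := {X | ∀ x, X x ∈ D.fiber x}
  add_mem' hX hY x := (D.fiber x).add_mem (hX x) (hY x)
  zero_mem' x := (D.fiber x).zero_mem
  smul_mem' f _ hX x := (D.fiber x).smul_mem (f x) (hX x)

theorem exists_global_frame (D : SmoothDistribution E C) (x : C) : ∃ (r : ℕ) (s : Fin r → VF E C),
    (∀ i, s i ∈ D.sections) ∧ ∀ᶠ y in 𝓝 x, LinearIndependent ℝ (fun i => s i y) ∧
      Submodule.span ℝ (range fun i => s i y) = D.fiber y := by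
  obtain ⟨r, s, U, hU, hx, hs, h⟩ := D.exists_frame x
  obtain ⟨χ, hχ, h1⟩ := VF.exists_bump (E := E) (hU.mem_nhds hx)
  choose S hS using fun i => VF.exists_global hU hχ (hs i)
  refine ⟨r, S, fun i y => ?_, ?_⟩
  · rw [hS]
    by_cases hy : y ∈ U
    · refine (D.fiber y).smul_mem _ ?_
      rw [← (h y hy).2]
      exact Submodule.subset_span ⟨i, rfl⟩
    · rw [image_eq_zero_of_notMem_tsupport fun h' => hy (hχ h'), zero_smul]
      exact zero_mem _
  · filter_upwards [h1, hU.mem_nhds hx] with y hy hyU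
    have : (fun i => S i y) = fun i => s i y := by
      funext i
      rw [hS, hy, Pi.one_apply, one_smul]
    rw [this]
    exact h y hyU

theorem exists_section (D : SmoothDistribution E C) {x : C} {v : TangentSpace 𝓘(ℝ, E) x}
    (hv : v ∈ D.fiber x) : ∃ X ∈ D.sections, X x = v := by
  obtain ⟨r, s, hs, h⟩ := D.exists_global_frame x
  have h := h.self_of_nhds.2
  rw [← h] at hv
  induction hv using Submodule.span_induction with
  | mem v hv =>
    obtain ⟨i, rfl⟩ := hv
    exact ⟨s i, hs i, rfl⟩
  | zero => exact ⟨0, zero_mem _, rfl⟩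
  | add v w _ _ hv hw =>
    obtain ⟨X, hX, rfl⟩ := hv
    obtain ⟨Y, hY, rfl⟩ := hw
    exact ⟨X + Y, add_mem hX hY, rfl⟩
  | smul c v _ hv =>
    obtain ⟨X, hX, rfl⟩ := hv
    exact ⟨c • X, fun y => (D.fiber y).smul_mem c (hX y), rfl⟩

theorem isCompl_sections [SigmaCompactSpace C] {D D' : SmoothDistribution E C}
    (h : ∀ x, IsCompl (D.fiber x) (D'.fiber x)) : IsCompl D.sections D'.sections := by
  constructor
  · refine Submodule.disjoint_def.2 fun X hX hX' => ContMDiffSection.ext fun x => ?_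
    exact Submodule.disjoint_def.1 (h x).disjoint _ (hX x) (hX' x)
  · rw [codisjoint_iff, Submodule.eq_top_iff']
    intro Y
    obtain ⟨X, hX⟩ : ∃ X : VF E C, ∀ x, X x ∈ {v | v ∈ D.fiber x ∧ Y x - v ∈ D'.fiber x} := by
      refine exists_contMDiffSection_forall_mem_convex_of_local (I := 𝓘(ℝ, E)) (n := ⊤)
        (F_fiber := E) (TangentSpace 𝓘(ℝ, E) : C → Type _) _ ?_ ?_
      · intro x v hv w hw a b _ _ hab
        refine ⟨add_mem ((D.fiber x).smul_mem a hv.1) ((D.fiber x).smul_mem b hw.1), ?_⟩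
        have : Y x - (a • v + b • w) = a • (Y x - v) + b • (Y x - w) := by
          have : Y x = (a + b) • Y x := by rw [hab, one_smul]
          conv_lhs => rw [this]
          module
        rw [this]
        exact add_mem ((D'.fiber x).smul_mem a hv.2) ((D'.fiber x).smul_mem b hw.2)
      · intro x
        obtain ⟨r, s, hs, hf⟩ := D.exists_global_frame x
        obtain ⟨m, w, hw, hg⟩ := D'.exists_global_frame x
        have hc (y : C) : (fun i => Sum.elim s w i y) =
            Sum.elim (fun i => s i y) (fun j => w j y) := by
          funext i
          cases i <;> rfl
        obtain ⟨c, hcY⟩ := (VF.eventually_basis (Sum.elim s w) (x := x)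
          (by
            rw [hc]
            refine hf.self_of_nhds.1.sum_type hg.self_of_nhds.1 ?_
            rw [hf.self_of_nhds.2, hg.self_of_nhds.2]
            exact (h x).disjoint)
          (by
            rw [hc, VF.span_sum_elim, hf.self_of_nhds.2, hg.self_of_nhds.2]
            exact (h x).sup_eq_top)).2 Y
        refine ⟨_, hcY, fun y => ∑ i, c (Sum.inl i) y • s i y, ?_, ?_⟩
        · intro y hy
          refine (ContMDiffAt.sum_section (s := Finset.univ)
            (t := fun i y => c (Sum.inl i) y • s i y) fun i _ => ?_).contMDiffWithinAt
          exact (hy.2 (Sum.inl i)).smul_section ((s i).contMDiff y)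
        · intro y hy
          refine ⟨sum_mem fun i _ => (D.fiber y).smul_mem _ (hs i y), ?_⟩
          rw [hy.1, Fintype.sum_sum_type]
          change (∑ i, c (Sum.inl i) y • s i y) + (∑ j, c (Sum.inr j) y • w j y) -
            (∑ i, c (Sum.inl i) y • s i y) ∈ _
          rw [add_sub_cancel_left]
          exact sum_mem fun j _ => (D'.fiber y).smul_mem _ (hw j y)
    refine Submodule.mem_sup.2 ⟨X, fun x => (hX x).1, Y - X, fun x => (hX x).2, ?_⟩
    exact add_sub_cancel X Y

end SmoothDistribution

variable (E C) in
/-- A regular foliation on `C`, given by its tangent distribution. -/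
structure Foliation extends SmoothDistribution E C where
  involutive : ∀ X ∈ toSmoothDistribution.sections, ∀ Y ∈ toSmoothDistribution.sections,
    ⁅X, Y⁆ ∈ toSmoothDistribution.sections

namespace Foliation

/-- The Lie-Rinehart algebra of vector fields tangent to the leaves. -/
def tangent (F : Foliation E C) : LieRinehartSubalgebra (SmoothFun E C) (VF E C) where
  __ := F.sections
  lie_mem' hX hY := F.involutive _ hX _ hY

theorem mem_tangent {F : Foliation E C} {X : VF E C} : X ∈ F.tangent ↔ ∀ x, X x ∈ F.fiber x :=
  Iff.rfl

/-- The distribution `G` is a complement of the tangent distribution of `F`. -/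
def IsComplement (F : Foliation E C) (G : SmoothDistribution E C) : Prop :=
  ∀ x, IsCompl (F.fiber x) (G.fiber x)

/-- The sections of a complement of the tangent distribution. -/
def IsComplement.toComplement [SigmaCompactSpace C] {F : Foliation E C} {G : SmoothDistribution E C}
    (h : F.IsComplement G) : LieForms.Complement F.tangent where
  carrier := G.sections
  isCompl := SmoothDistribution.isCompl_sections h

/-- The two-form `ωC` is closed and its kernel at every point is the tangent space of the leaf. -/
structure IsPresymplectic (F : Foliation E C) (ωC : VF E C [⋀^Fin 2]→ₗ[SmoothFun E C] SmoothFun E C) :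
    Prop where
  closed : LieForms.d ωC = 0
  mem_fiber_iff : ∀ (x : C) (X : VF E C), X x ∈ F.fiber x ↔ ∀ Y : VF E C, ωC ![X, Y] x = 0

theorem IsPresymplectic.exists_eq [SigmaCompactSpace C] {F : Foliation E C}
    {ωC : VF E C [⋀^Fin 2]→ₗ[SmoothFun E C] SmoothFun E C} (hω : F.IsPresymplectic ωC)
    (l : Module.Dual (SmoothFun E C) (VF E C)) (hl : ∀ X ∈ F.tangent, l X = 0) :
    ∃ Z, ∀ Y, ωC ![Z, Y] = l Y := by
  have hright (X Y : VF E C) (x : C) : ωC ![X, Y] x = - LieForms.contract ωC Y X x :=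
    congrArg (fun f : SmoothFun E C => f x) (LieForms.contract_swap ωC X Y)
  have hleft {X X' : VF E C} {x : C} (h : X x = X' x) (Y : VF E C) : ωC ![X, Y] x = ωC ![X', Y] x := by
    have h2 := VF.tensorial (LieForms.contract ωC Y) h
    rw [hright, hright, h2]
  have hF {x : C} (X : VF E C) (hX : X x ∈ F.fiber x) (Y : VF E C) :
      ωC ![Y, X] x = 0 ∧ l X x = 0 := by
    constructor
    · have := (hω.mem_fiber_iff x X).1 hX Y
      rw [LieForms.contract_swap]
      exact neg_eq_zero.2 this
    · obtain ⟨X', hX', h⟩ := F.exists_section hX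
      rw [VF.tensorial l h.symm, hl X' hX']
      rfl
  have hsum {n : ℕ} (c : Fin n → ℝ) (w : Fin n → VF E C) (x : C) (Y : VF E C) :
      ωC ![∑ i, c i • w i, Y] x = ∑ i, c i * ωC ![w i, Y] x := by
    simp only [hright, VF.map_sum_apply, mul_neg, Finset.sum_neg_distrib]
  obtain ⟨Z, hZ⟩ : ∃ Z : VF E C, ∀ x, Z x ∈
      {v | ∃ Z : VF E C, Z x = v ∧ ∀ Y, ωC ![Z, Y] x = l Y x} := by
    refine exists_contMDiffSection_forall_mem_convex_of_local (I := 𝓘(ℝ, E)) (n := ⊤)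
      (F_fiber := E) (TangentSpace 𝓘(ℝ, E) : C → Type _) _ ?_ ?_
    · rintro x _ ⟨Z, rfl, hZ⟩ _ ⟨W, rfl, hW⟩ a b _ _ hab
      refine ⟨a • Z + b • W, rfl, fun Y => ?_⟩
      have h1 : ωC ![a • Z + b • W, Y] = a • ωC ![Z, Y] + b • ωC ![W, Y] := by
        change LieForms.contract ωC (a • Z + b • W) Y = _
        rw [map_add, LinearMap.map_smul_of_tower, LinearMap.map_smul_of_tower]
        rfl
      rw [h1]
      change a * ωC ![Z, Y] x + b * ωC ![W, Y] x = _
      rw [hZ, hW, ← add_mul, hab, one_mul]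
    · intro x
      obtain ⟨r, s, hs, hf⟩ := F.exists_global_frame x
      obtain ⟨K, hK⟩ := (F.fiber x).exists_isCompl
      have : FiniteDimensional ℝ (TangentSpace 𝓘(ℝ, E) x) :=
        inferInstanceAs (FiniteDimensional ℝ E)
      obtain ⟨m, ⟨b⟩⟩ : ∃ m, Nonempty (Module.Basis (Fin m) ℝ K) :=
        ⟨_, ⟨Module.finBasis ℝ K⟩⟩
      choose w hw using fun i => VF.exists_extend x (b i : TangentSpace 𝓘(ℝ, E) x)
      have hc (y : C) : (fun i => Sum.elim s w i y) =
          Sum.elim (fun i => s i y) (fun j => w j y) := by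
        funext i
        cases i <;> rfl
      have hwx : (fun j => w j x) = K.subtype ∘ b := funext hw
      have hwspan : Submodule.span ℝ (range fun j => w j x) = K := by
        rw [hwx, range_comp, ← Submodule.map_span, b.span_eq, Submodule.map_top,
          Submodule.range_subtype]
      have hwli : LinearIndependent ℝ fun j => w j x := by
        rw [hwx]
        exact b.linearIndependent.map' _ K.ker_subtype
      have hev := (VF.eventually_basis (Sum.elim s w) (x := x)
          (by
            rw [hc]
            refine hf.self_of_nhds.1.sum_type hwli ?_
            rw [hf.self_of_nhds.2, hwspan]
            exact hK.disjoint)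
          (by
            rw [hc, VF.span_sum_elim, hf.self_of_nhds.2, hwspan]
            exact hK.sup_eq_top)).1
      let T : C → (Fin m → ℝ) →L[ℝ] (Fin m → ℝ) := fun y => ∑ i, ∑ j, ωC ![w i, w j] y •
        (ContinuousLinearMap.proj i : (Fin m → ℝ) →L[ℝ] ℝ).smulRight (Pi.single j 1)
      have hT (y : C) (c : Fin m → ℝ) (j : Fin m) : T y c j = ∑ i, c i * ωC ![w i, w j] y := by
        simp [T, Pi.single_apply, mul_comm]
      have hTs (y : C) : ContMDiffAt 𝓘(ℝ, E) 𝓘(ℝ, (Fin m → ℝ) →L[ℝ] (Fin m → ℝ)) ∞ T y :=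
        ContMDiffAt.sum fun i _ => ContMDiffAt.sum fun j _ =>
          ((ωC ![w i, w j]).contMDiff y).smul contMDiffAt_const
      have hTx : Function.Bijective (T x) := by
        have hinj : Function.Injective (T x).toLinearMap → Function.Bijective (T x) := fun h =>
          ⟨h, LinearMap.injective_iff_surjective.1 h⟩
        refine hinj ((injective_iff_map_eq_zero _).2 fun c hc0 => ?_)
        have hZF : (∑ i, c i • w i) x ∈ F.fiber x := by
          refine (hω.mem_fiber_iff x _).2 fun Y => ?_
          refine VF.dual_ext hev.self_of_nhds.2 (LieForms.contract ωC (∑ i, c i • w i)) 0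
            (fun i => ?_) Y
          cases i with
          | inl i => exact (hF (s i) (hs i x) _).1
          | inr j => exact (hsum c w x (w j)).trans ((hT x c j).symm.trans (congrFun hc0 j))
        have hZ : (∑ i, c i • w i) x = ∑ i, c i • w i x := VF.sum_apply (fun i => c i • w i) x
        have hZK : (∑ i, c i • w i) x ∈ K := by
          rw [hZ]
          refine sum_mem fun i _ => K.smul_mem _ ?_
          rw [hw]
          exact (b i).2
        have h0 := Submodule.disjoint_def.1 hK.disjoint _ hZF hZK
        rw [hZ] at h0
        exact funext (Fintype.linearIndependent_iff.1 hwli c h0)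
      have hTe := VF.eventually_inverse T (Eventually.of_forall hTs) hTx
      have hall := hev.and (hf.and hTe)
      refine ⟨_, hall, fun y => ∑ i, (T y).inverse (fun j => l (w j) y) i • w i y, ?_, ?_⟩
      · intro y hy
        refine (ContMDiffAt.sum_section (s := Finset.univ)
          (t := fun i y => (T y).inverse (fun j => l (w j) y) i • w i y)
          fun i _ => ?_).contMDiffWithinAt
        refine ContMDiffAt.smul_section ?_ ((w i).contMDiff y)
        have hg : ContMDiffAt 𝓘(ℝ, E) 𝓘(ℝ, Fin m → ℝ) ∞ (fun y j => l (w j) y) y :=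
          contMDiffAt_pi_space.2 fun j => (l (w j)).contMDiff y
        have h2 : ContMDiffAt 𝓘(ℝ, E) 𝓘(ℝ, (Fin m → ℝ) →L[ℝ] (Fin m → ℝ)) ∞
          (fun y => (T y).inverse) y := hy.2.2.2
        have h3 := h2.clm_apply hg
        exact contMDiffAt_pi_space.1 h3 i
      · intro y hy
        set c := (T y).inverse (fun j => l (w j) y) with hcdef
        have hTc := VF.inverse_apply_eq (T y) hy.2.2.1 (fun j => l (w j) y)
        refine ⟨∑ i, c i • w i, VF.sum_apply (fun i => c i • w i) y, fun Y => ?_⟩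
        refine VF.dual_ext hy.1.2 (LieForms.contract ωC (∑ i, c i • w i)) l (fun i => ?_) Y
        cases i with
        | inl i => exact (hF (s i) (hs i y) _).1.trans (hF (s i) (hs i y) (s i)).2.symm
        | inr j => exact (hsum c w y (w j)).trans ((hT y c j).symm.trans (congrFun hTc j))
  refine ⟨Z, fun Y => ContMDiffMap.ext fun x => ?_⟩
  obtain ⟨Z', h1, h2⟩ := hZ x
  rw [hleft h1.symm, h2]

theorem IsPresymplectic.isTransverselySymplectic [SigmaCompactSpace C] {F : Foliation E C}
    {ωC : VF E C [⋀^Fin 2]→ₗ[SmoothFun E C] SmoothFun E C} (hω : F.IsPresymplectic ωC) :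
    LieForms.IsTransverselySymplectic ωC F.tangent where
  closed := hω.closed
  mem_iff X := by
    refine ⟨fun h Y => ContMDiffMap.ext fun x => (hω.mem_fiber_iff x X).1 (h x) Y, fun h x => ?_⟩
    exact (hω.mem_fiber_iff x X).2 fun Y => by rw [h]; rfl
  exists_eq := hω.exists_eq

end Foliation
end Foliations

section Extension

variable {E : Type*} [NormedAddCommGroup E] [NormedSpace ℝ E] [FiniteDimensional ℝ E]
  {C : Type*} [TopologicalSpace C] [ChartedSpace E C] [IsManifold 𝓘(ℝ, E) ∞ C] [T2Space C]

namespace SmoothDistribution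

theorem exists_local_projection (D : SmoothDistribution E C) (x : C) :
    ∃ (U : Set C) (Q : ∀ y : C, TangentSpace 𝓘(ℝ, E) y →ₗ[ℝ] TangentSpace 𝓘(ℝ, E) y),
      IsOpen U ∧ x ∈ U ∧ (∀ y v, Q y v ∈ D.fiber y) ∧ (∀ y ∈ U, ∀ v ∈ D.fiber y, Q y v = v) ∧
      ∀ Y : VF E C, ContMDiffOn 𝓘(ℝ, E) 𝓘(ℝ, E).tangent ∞
        (fun y => (Q y (Y y) : TangentBundle 𝓘(ℝ, E) C)) U := by
  classical
  obtain ⟨r, s, hs, hf⟩ := D.exists_global_frame x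
  obtain ⟨K, hK⟩ := (D.fiber x).exists_isCompl
  have : FiniteDimensional ℝ (TangentSpace 𝓘(ℝ, E) x) :=
    inferInstanceAs (FiniteDimensional ℝ E)
  obtain ⟨m, ⟨b⟩⟩ : ∃ m, Nonempty (Module.Basis (Fin m) ℝ K) := ⟨_, ⟨Module.finBasis ℝ K⟩⟩
  choose w hw using fun i => VF.exists_extend x (b i : TangentSpace 𝓘(ℝ, E) x)
  have hc (y : C) : (fun i => Sum.elim s w i y) =
      Sum.elim (fun i => s i y) (fun j => w j y) := by
    funext i
    cases i <;> rfl
  have hwx : (fun j => w j x) = K.subtype ∘ b := funext hw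
  have hwspan : Submodule.span ℝ (range fun j => w j x) = K := by
    rw [hwx, range_comp, ← Submodule.map_span, b.span_eq, Submodule.map_top,
      Submodule.range_subtype]
  have hwli : LinearIndependent ℝ fun j => w j x := by
    rw [hwx]
    exact b.linearIndependent.map' _ K.ker_subtype
  have hli0 : LinearIndependent ℝ fun i => Sum.elim s w i x := by
    rw [hc]
    refine hf.self_of_nhds.1.sum_type hwli ?_
    rw [hf.self_of_nhds.2, hwspan]
    exact hK.disjoint
  have hsp0 : Submodule.span ℝ (range fun i => Sum.elim s w i x) = ⊤ := by
    rw [hc, VF.span_sum_elim, hf.self_of_nhds.2, hwspan]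
    exact hK.sup_eq_top
  obtain ⟨U, hUs, hU, hxU⟩ := eventually_nhds_iff.1
    ((VF.eventually_basis (Sum.elim s w) hli0 hsp0).1.and hf)
  have hcompl : ∀ y ∈ U, IsCompl (D.fiber y) (Submodule.span ℝ (range fun j => w j y)) := by
    intro y hy
    obtain ⟨⟨hli, hsp⟩, -, hF⟩ := hUs y hy
    rw [hc] at hli hsp
    rw [← hF]
    refine ⟨?_, ?_⟩
    · have := hli.disjoint_span_image (s := range Sum.inl) (t := range Sum.inr)
        isCompl_range_inl_range_inr.disjoint
      rwa [← range_comp, ← range_comp] at this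
    · rw [codisjoint_iff, ← VF.span_sum_elim, hsp]
  let Q (y : C) : TangentSpace 𝓘(ℝ, E) y →ₗ[ℝ] TangentSpace 𝓘(ℝ, E) y :=
    if hy : y ∈ U then Submodule.projection _ _ (hcompl y hy) else 0
  have hQ {y : C} (hy : y ∈ U) : Q y = Submodule.projection _ _ (hcompl y hy) := dif_pos hy
  refine ⟨U, Q, hU, hxU, fun y v => ?_, fun y hy v hv => ?_, fun Y y hy => ?_⟩
  · by_cases hy : y ∈ U
    · rw [hQ hy]
      exact Submodule.projection_apply_mem _ _
    · have : Q y = 0 := dif_neg hy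
      rw [this]
      exact zero_mem _
  · rw [hQ hy]
    exact Submodule.projection_apply_left (hcompl y hy) ⟨v, hv⟩
  · obtain ⟨c, hcY⟩ := (VF.eventually_basis (Sum.elim s w) (hUs y hy).1.1 (hUs y hy).1.2).2 Y
    have hloc : ∀ᶠ z in 𝓝 y, Q z (Y z) = ∑ i, c (Sum.inl i) z • s i z := by
      filter_upwards [hcY, hU.mem_nhds hy] with z hz hzU
      have h1 : ∑ i, c (Sum.inl i) z • s i z ∈ D.fiber z :=
        sum_mem fun i _ => (D.fiber z).smul_mem _ (hs i z)
      have h2 : ∑ j, c (Sum.inr j) z • w j z ∈ Submodule.span ℝ (range fun j => w j z) :=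
        sum_mem fun j _ => Submodule.smul_mem _ _ (Submodule.subset_span ⟨j, rfl⟩)
      rw [hz.1, Fintype.sum_sum_type, map_add, hQ hzU]
      exact (congrArg₂ (· + ·) (Submodule.projection_apply_left (hcompl z hzU) ⟨_, h1⟩)
        ((Submodule.projection_apply_eq_zero_iff (hcompl z hzU)).2 h2)).trans (add_zero _)
    have hsm : ContMDiffAt 𝓘(ℝ, E) 𝓘(ℝ, E).tangent ∞
        (fun z => ((∑ i, c (Sum.inl i) z • s i z : TangentSpace 𝓘(ℝ, E) z) :
          TangentBundle 𝓘(ℝ, E) C)) y :=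
      ContMDiffAt.sum_section (s := Finset.univ) (t := fun i z => c (Sum.inl i) z • s i z)
        fun i _ => ContMDiffAt.smul_section (hcY.self_of_nhds.2 (Sum.inl i)) ((s i).contMDiff y)
    refine (hsm.congr_of_eventuallyEq ?_).contMDiffWithinAt
    filter_upwards [hloc] with z hz
    rw [hz]

theorem exists_projection [SigmaCompactSpace C] (D : SmoothDistribution E C) :
    ∃ P : VF E C →ₗ[SmoothFun E C] D.sections, ∀ X : D.sections, P X = X := by
  choose U Q hU hxU hQF hQid hQs using D.exists_local_projection
  obtain ⟨ρ, hρ⟩ := SmoothPartitionOfUnity.exists_isSubordinate 𝓘(ℝ, E) (s := univ) isClosed_univ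
    U hU (fun x _ => mem_iUnion.2 ⟨x, hxU x⟩)
  have hfin (y : C) (f : C → TangentSpace 𝓘(ℝ, E) y) :
      (Function.support fun i => ρ i y • f i).Finite :=
    (ρ.locallyFinite.point_finite y).subset fun i hi => left_ne_zero_of_smul hi
  have hsm (Y : VF E C) : ContMDiff 𝓘(ℝ, E) 𝓘(ℝ, E).tangent ∞
      (fun y => ((∑ᶠ i, ρ i y • Q i y (Y y) : TangentSpace 𝓘(ℝ, E) y) :
        TangentBundle 𝓘(ℝ, E) C)) := by
    refine ContMDiff.finsum_section_of_locallyFinite (t := fun i y => ρ i y • Q i y (Y y)) ?_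
      fun i => ?_
    · exact ρ.locallyFinite.subset fun i y hy => left_ne_zero_of_smul hy
    · exact ContMDiffOn.smul_section_of_tsupport ((ρ i).contMDiff.contMDiffOn) (hU i) (hρ i)
        (hQs i Y)
  refine ⟨{ toFun := fun Y => ⟨⟨fun y => ∑ᶠ i, ρ i y • Q i y (Y y), hsm Y⟩, fun y => ?_⟩
            map_add' := fun Y Z => ?_
            map_smul' := fun f Y => ?_ }, fun X => ?_⟩
  · exact finsum_induction (fun v => v ∈ D.fiber y) (zero_mem _) (fun _ _ hv hw => add_mem hv hw)
      fun i => (D.fiber y).smul_mem _ (hQF i y _)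
  · refine Subtype.ext (ContMDiffSection.ext fun y => ?_)
    change ∑ᶠ i, ρ i y • Q i y (Y y + Z y) = ∑ᶠ i, ρ i y • Q i y (Y y) + ∑ᶠ i, ρ i y • Q i y (Z y)
    rw [← finsum_add_distrib (hfin y _) (hfin y _)]
    exact finsum_congr fun i => by rw [map_add, smul_add]
  · refine Subtype.ext (ContMDiffSection.ext fun y => ?_)
    change ∑ᶠ i, ρ i y • Q i y (f y • Y y) = f y • ∑ᶠ i, ρ i y • Q i y (Y y)
    rw [smul_finsum' _ (hfin y _)]
    exact finsum_congr fun i => by rw [map_smul, smul_comm]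
  · refine Subtype.ext (ContMDiffSection.ext fun y => ?_)
    change ∑ᶠ i, ρ i y • Q i y ((X : VF E C) y) = (X : VF E C) y
    have h1 : ∀ i, ρ i y • Q i y ((X : VF E C) y) = ρ i y • (X : VF E C) y := by
      intro i
      by_cases hi : y ∈ tsupport (ρ i)
      · rw [hQid i y (hρ i hi) _ (X.2 y)]
      · rw [image_eq_zero_of_notMem_tsupport hi, zero_smul, zero_smul]
    rw [finsum_congr h1, ← finsum_smul' (ρ.locallyFinite.point_finite y),
      ρ.sum_eq_one (mem_univ y), one_smul]

end SmoothDistribution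
end Extension

section Main

variable {E : Type*} [NormedAddCommGroup E] [NormedSpace ℝ E] [FiniteDimensional ℝ E]
  {C : Type*} [TopologicalSpace C] [ChartedSpace E C] [IsManifold 𝓘(ℝ, E) ∞ C] [T2Space C]

variable (E C) in
/-- The differential forms of degree `k` on `C`, as alternating `C^∞(C)`-multilinear maps on vector
fields. -/
abbrev Form (k : ℕ) : Type _ := VF E C [⋀^Fin k]→ₗ[SmoothFun E C] SmoothFun E C

namespace Foliation

/-- The leafwise differential forms of degree `k`, i.e. the sections of `∧^k T*F`, as alternating
`C^∞(C)`-multilinear maps on vector fields tangent to the leaves. -/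
abbrev LeafForm (F : Foliation E C) (k : ℕ) : Type _ :=
  F.tangent [⋀^Fin k]→ₗ[SmoothFun E C] SmoothFun E C

theorem restrict_surjective [SigmaCompactSpace C] (F : Foliation E C) (k : ℕ) :
    Function.Surjective (LieForms.restrict F.tangent k) := by
  obtain ⟨P, hP⟩ := F.toSmoothDistribution.exists_projection
  exact fun α => ⟨LieForms.extend (S := F.tangent) P k α, LieForms.restrict_extend _ hP k α⟩

/-- The transverse differentiation map `d_ν : H^k(F) → H^k(F; N*F)`. -/
def dnu [SigmaCompactSpace C] (F : Foliation E C) (k : ℕ) :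
    LieForms.Cohomology (SmoothFun E C) F.tangent (SmoothFun E C) k →ₗ[ℝ]
      LieForms.Cohomology (SmoothFun E C) F.tangent (LieForms.Conormal F.tangent) k :=
  LieForms.dnu F.tangent F.restrict_surjective k

/-- The module of sections of a complement `G`, with its Bott connection. -/
abbrev IsComplement.Sections [SigmaCompactSpace C] {F : Foliation E C} {G : SmoothDistribution E C}
    (hG : F.IsComplement G) : Type _ := hG.toComplement.carrier

/-- The extension `j α` of a leafwise form by zero on a complement. -/
def IsComplement.j [SigmaCompactSpace C] {F : Foliation E C} {G : SmoothDistribution E C}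
    (hG : F.IsComplement G) (k : ℕ) : F.LeafForm k →ₗ[ℝ] Form E C k :=
  LieForms.extend hG.toComplement.prS k

/-- The isomorphism `ω♭ : Γ(G) → Γ(G*)`, `y ↦ ω (y, ·)`. -/
def IsPresymplectic.flat [SigmaCompactSpace C] {F : Foliation E C} {ωC : Form E C 2}
    (hω : F.IsPresymplectic ωC) {G : SmoothDistribution E C} (hG : F.IsComplement G) :
    hG.Sections ≃ₗ[SmoothFun E C] Module.Dual (SmoothFun E C) hG.Sections :=
  hω.isTransverselySymplectic.flatG hG.toComplement

/-- The map `Φ : Ω^k(F) → Ω^k(F; G)`: the component in `∧^k T*F ⊗ G*` of `d (j α)`, followed by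
`-Id ⊗ (ω♭)⁻¹`. -/
def IsPresymplectic.Phi [SigmaCompactSpace C] {F : Foliation E C} {ωC : Form E C 2}
    (hω : F.IsPresymplectic ωC) {G : SmoothDistribution E C} (hG : F.IsComplement G) (k : ℕ) :
    F.LeafForm k →ₗ[ℝ] (F.tangent [⋀^Fin k]→ₗ[SmoothFun E C] hG.Sections) :=
  LieForms.mapCoeff (-(hω.flat hG).symm.toLinearMap) k ∘ₗ
    LieForms.mixed F.tangent hG.toComplement.carrier.subtype k ∘ₗ LieForms.d ∘ₗ hG.j k

/-- The map induced by `Φ` in cohomology, with values in `H^k(F; NF)` through the identification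
of `G` with `NF`. -/
def IsPresymplectic.cohPhi [SigmaCompactSpace C] {F : Foliation E C} {ωC : Form E C 2}
    (hω : F.IsPresymplectic ωC) {G : SmoothDistribution E C} (hG : F.IsComplement G)
    (hΦ : LieForms.IsChainMapUpToSign (hω.Phi hG)) (k : ℕ) :
    LieForms.Cohomology (SmoothFun E C) F.tangent (SmoothFun E C) k →ₗ[ℝ]
      LieForms.Cohomology (SmoothFun E C) F.tangent (LieForms.Normal F.tangent) k :=
  hG.toComplement.cohNormal k ∘ₗ LieForms.cohMap (hω.Phi hG) hΦ k

/-- The map `[-Id ⊗ (ω♭)⁻¹] : H^k(F; N*F) → H^k(F; NF)`. -/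
def IsPresymplectic.cohNegFlatSymm [SigmaCompactSpace C] {F : Foliation E C} {ωC : Form E C 2}
    (hω : F.IsPresymplectic ωC) (k : ℕ) :
    LieForms.Cohomology (SmoothFun E C) F.tangent (LieForms.Conormal F.tangent) k →ₗ[ℝ]
      LieForms.Cohomology (SmoothFun E C) F.tangent (LieForms.Normal F.tangent) k :=
  hω.isTransverselySymplectic.cohNegFlatSymm k

end Foliation
end Main

end Geometry

end

open scoped Manifold ContDiff

noncomputable section

namespace LieForms

variable {A L : Type*} [CommRing A] [Algebra ℝ A] [LieRing L] [Module A L] [LieRingModule L A]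
  [LieAlgebra ℝ L] [LieRinehartRing A L] [LieRinehartAlgebra ℝ A L]
  {σ : L [⋀^Fin 2]→ₗ[A] A} {S : LieRinehartSubalgebra A L}

/-! ### Forms extended by zero on a complement, and the commutator of this extension with `d` -/

namespace Complement

variable (G : Complement S)

/-! The argument is algebraic and takes place over a Lie-Rinehart pair `(A, L)` with a subalgebra
`S`: functions and vector fields on `C`, and the fields tangent to the leaves. The geometry enters
in three ways. A complementary distribution gives a complementary module of sections. The
presymplectic form induces an invertible `ω♭` on sections. Every leafwise form extends to `C`.

The main object is the commutator `D α = d (j α) - j (d α)`, which is `dExtend`. Restriction to the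
leaves commutes with `d` and undoes `j`, so `D α` vanishes on the leaves and its conormal part `p (D
α)` is defined. The correction `j (d α)` vanishes as soon as one argument lies in `G`. The component
of `d (j α)` in `∧^k T*F ⊗ G*` is therefore `p (D α)`, read through `G ≅ NF` (`mixed_d_extend`), and
`Φ = -K ∘ p ∘ D` with `K : N*F → G` the inverse of `ω♭` (`phi_eq`).

Each factor has a simple relation to the differentials. From `d ∘ d = 0` one gets `D (d α) = d (j (d
α)) = -d (D α)`. The map `p` commutes with the differentials. So does `-K`, because `K` is parallel:
followed by the parallel injection `G → NF` it becomes `(ω♭)⁻¹`, which is parallel since `ω` is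
closed with kernel `S`. Hence `Φ ∘ d = -d ∘ Φ`, and `D` is the only source of the sign.

If `α` is closed, then `D α = d (j α)` and `j α` is one of the extensions allowed in the definition
of `d_ν`. So `p (D α)` represents `d_ν [α]`, and after the identification with `NF` the cocycle `Φ
α` is `-(ω♭)⁻¹ (p (D α))` on the nose. The complement then survives only in the choice of extension,
to which `d_ν` is insensitive. This is the independence of `G`. -/

theorem toNormal_injective : Function.Injective G.toNormal := by
  refine (injective_iff_map_eq_zero _).2 fun y hy => ?_
  have hS : (y : L) ∈ S := (Submodule.Quotient.mk_eq_zero S.toSubmodule).1 hy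
  exact (G.prG_coe y).symm.trans (G.prG_eq_zero hS)

theorem toNormal_surjective : Function.Surjective G.toNormal := fun n => by
  obtain ⟨y, rfl⟩ := Submodule.mkQ_surjective _ n
  refine ⟨G.prG y, ?_⟩
  conv_rhs => rw [← G.prG_add_prS y, map_add]
  exact left_eq_add.2 ((Submodule.Quotient.mk_eq_zero _).2 (G.prS y).2)

theorem prS_eq_zero (y : G.carrier) : G.prS (y : L) = 0 :=
  (Submodule.projectionOnto_apply_eq_zero_iff G.isCompl).2 y.2

/-- Forms extended by zero have no mixed component along the complement. -/
theorem mixed_extend (k : ℕ) (α : S [⋀^Fin (k + 1)]→ₗ[A] A) :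
    mixed S G.carrier.subtype k (extend G.prS (k + 1) α) = 0 := by
  ext V y
  -- The last argument lies in `G`, so the projection onto `S` along `G` kills it.
  refine α.map_coord_zero (Fin.last k) ?_
  simpa using G.prS_eq_zero y

/-- Restriction commutes with `d` and is a left inverse of extension by zero, so both terms restrict
to `d α`. Without the correction term, `d (j α)` vanishes on `S` only when `α` is closed, and `p`
could not be applied to it for general `α`. -/
theorem d_extend_sub_mem_relForms (k : ℕ) (α : S [⋀^Fin k]→ₗ[A] A) :
    d (extend G.prS k α) - extend G.prS (k + 1) (d α) ∈ relForms S (k + 1) := by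
  change restrict S (k + 1) _ = 0
  rw [map_sub, restrict_d, restrict_extend _ G.prS_coe, restrict_extend _ G.prS_coe, sub_self]

/-- The component vanishing on the subalgebra of the differential of a form extended by zero. -/
def dExtend (k : ℕ) (α : S [⋀^Fin k]→ₗ[A] A) : relForms S (k + 1) :=
  ⟨_, G.d_extend_sub_mem_relForms k α⟩

/-- Since `d ∘ d = 0`, each side keeps only its term `d (j (d α))`: it enters `D (d α)` with a plus
sign and `d (D α)` with a minus sign. The sign in `Φ ∘ d = -d ∘ Φ` comes from here. -/
theorem dExtend_d (k : ℕ) (α : S [⋀^Fin k]→ₗ[A] A) :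
    G.dExtend (k + 1) (d α) = -⟨d (G.dExtend k α), d_mem_relForms (G.dExtend k α).2⟩ := by
  refine Subtype.ext ?_
  change d (extend G.prS (k + 1) (d α)) - extend G.prS (k + 2) (d (d α)) =
    -d (d (extend G.prS k α) - extend G.prS (k + 1) (d α))
  rw [d_d, map_zero, sub_zero, map_sub, d_d, zero_sub, neg_neg]

/-- The correction `j (d α)` does not contribute to the mixed component, so `d (j α)` may be
replaced by a form that vanishes on `S`. For such a form the value on `(V₁, …, V_k, y)` depends only
on the class of `y` in `L / S`. This expresses the component in terms of `p`, whose compatibility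
with the differentials is known. -/
theorem mixed_d_extend (k : ℕ) (α : S [⋀^Fin k]→ₗ[A] A) :
    mixed S G.carrier.subtype k (d (extend G.prS k α)) =
      mapCoeff G.toNormal.dualMap k (conormalPart S k (G.dExtend k α)) := by
  have h : mixed S G.carrier.subtype k (G.dExtend k α : L [⋀^Fin (k + 1)]→ₗ[A] A) =
      mixed S G.carrier.subtype k (d (extend G.prS k α)) := by
    change mixed S G.carrier.subtype k (_ - _) = _
    rw [map_sub, mixed_extend]
    exact sub_zero (mixed S G.carrier.subtype k (d (extend G.prS k α)))
  rw [← h]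
  -- Both sides evaluate the same form on `V` followed by an element of `G`.
  rfl

end Complement

/-! ### The map `Φ`: factorization, anticommutation with `d`, and its effect in cohomology -/

namespace IsTransverselySymplectic

variable (hω : IsTransverselySymplectic σ S) (G : Complement S)

/-- The map `(ω♭)⁻¹` from the conormal module to a complement. -/
def conormalToComplement : Conormal S →ₗ[A] G.carrier :=
  (hω.flatG G).symm.toLinearMap ∘ₗ G.toNormal.dualMap

/-- The two inverses of `ω♭`, on `G` and on the normal module, correspond under `G ≅ L / S`. A
functional on the normal module can be tested on classes of elements of `G`, and there both inverses
solve the same equation `ω (z, y) = β ȳ`. -/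
theorem toNormal_conormalToComplement (β : Conormal S) :
    G.toNormal (hω.conormalToComplement G β) = hω.flatEquiv.symm β := by
  rw [LinearEquiv.eq_symm_apply]
  refine LinearMap.ext fun n => ?_
  obtain ⟨y, rfl⟩ := G.toNormal_surjective n
  -- On classes of elements of `G` the normal `ω♭` is `ω` itself, so the goal is the defining
  -- equation of the inverse on `G`, evaluated at `y`.
  exact LinearMap.congr_fun ((hω.flatG G).apply_symm_apply (G.toNormal.dualMap β)) y

/-- `G → L / S` is injective and intertwines the two Bott connections, so the identity can be
checked in the normal module. There the map is `(ω♭)⁻¹`, which is parallel because `ω` is closed and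
is annihilated by `S`. No connection on the dual of `G` is needed. -/
theorem conormalToComplement_lie (x : S) (β : Conormal S) :
    hω.conormalToComplement G ⁅x, β⁆ = ⁅x, hω.conormalToComplement G β⁆ := by
  apply G.toNormal_injective
  rw [G.toNormal_lie, toNormal_conormalToComplement, toNormal_conormalToComplement,
    flatEquiv_symm_lie]

/-- The component of `d (j α)` in the dual of a complement, followed by `-(ω♭)⁻¹`. -/
def phi (k : ℕ) : (S [⋀^Fin k]→ₗ[A] A) →ₗ[ℝ] (S [⋀^Fin k]→ₗ[A] G.carrier) :=
  mapCoeff (-(hω.flatG G).symm.toLinearMap) k ∘ₗ mixed S G.carrier.subtype k ∘ₗ d ∘ₗ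
    extend G.prS k

/-- The minus sign in `Φ` cancels the antisymmetry of `ω`: with `β = ω (v, ·)` and the mixed
component at `V` equal to `ω (u, ·)`, the value is `β (-u) = -ω (v, u) = ω (u, v)`, which is that
component evaluated at `v = (ω♭)⁻¹ β`. -/
theorem apply_phi (k : ℕ) (α : S [⋀^Fin k]→ₗ[A] A) (V : Fin k → S)
    (β : Module.Dual A G.carrier) :
    β (hω.phi G k α V) =
      d (extend G.prS k α) (Fin.snoc (fun i => (V i : L)) ((hω.flatG G).symm β : L)) := by
  obtain ⟨v, rfl⟩ := (hω.flatG G).surjective β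
  -- `u` is the preimage under `ω♭` of the mixed component of `d (j α)` at `V`; thus `Φ α V` is
  -- `-u`.
  obtain ⟨u, hu⟩ := (hω.flatG G).surjective
    (mixed S G.carrier.subtype k (d (extend G.prS k α)) V)
  have h₁ : hω.phi G k α V = -u := by
    rw [← (hω.flatG G).symm_apply_apply u, hu]
    rfl
  rw [h₁, LinearEquiv.symm_apply_apply, map_neg]
  have h₂ : hω.flatG G v u = -hω.flatG G u v := contract_swap σ v u
  rw [h₂, neg_neg, hu]
  rfl

/-- This splits `Φ` into a commutator that anticommutes with `d`, followed by the conormal part and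
a parallel change of coefficients, both of which commute with it. -/
theorem phi_eq (k : ℕ) (α : S [⋀^Fin k]→ₗ[A] A) :
    hω.phi G k α =
      mapCoeff (-hω.conormalToComplement G) k (conormalPart S k (G.dExtend k α)) := by
  change mapCoeff _ k (mixed S G.carrier.subtype k (d (extend G.prS k α))) = _
  rw [G.mixed_d_extend]
  rfl

/-- The conormal part is compatible with `d` for forms vanishing on `S`, and a parallel map of
coefficients always is. Only the sign of `dExtend_d` is left. -/
theorem phi_d (k : ℕ) (α : S [⋀^Fin k]→ₗ[A] A) :
    hω.phi G (k + 1) (d α) = -d (hω.phi G k α) := by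
  have hK : ∀ (x : S) (β : Conormal S), (-hω.conormalToComplement G) ⁅x, β⁆ =
      ⁅x, (-hω.conormalToComplement G) β⁆ := fun x β => by
    rw [LinearMap.neg_apply, LinearMap.neg_apply, lie_neg, conormalToComplement_lie]
  -- By linearity the sign passes first through the conormal part and then through the map of
  -- coefficients.
  have h := (congrArg (mapCoeff (-hω.conormalToComplement G) (k + 1)) (map_neg
    (conormalPart S (k + 1)) ⟨d (G.dExtend k α), d_mem_relForms (G.dExtend k α).2⟩)).trans
    (map_neg _ _)
  rw [phi_eq, phi_eq, G.dExtend_d, h, conormalPart_d, mapCoeff_d _ hK]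

/-- Already for forms, before passing to cohomology, the identification `G ≅ L / S` turns `Φ` into
`-(ω♭)⁻¹ ∘ p ∘ D`. On the right the complement enters only through the extension `j` inside `D`. -/
theorem mapCoeff_toNormal_phi (k : ℕ) (α : S [⋀^Fin k]→ₗ[A] A) :
    mapCoeff G.toNormal k (hω.phi G k α) =
      mapCoeff (-hω.flatEquiv.symm.toLinearMap) k (conormalPart S k (G.dExtend k α)) := by
  rw [phi_eq]
  refine AlternatingMap.ext fun V => ?_
  exact (map_neg G.toNormal _).trans (congrArg _ (hω.toNormal_conormalToComplement G _))

/-- For closed `α` the commutator reduces to `d (j α)`, and `j α` is an admissible extension in the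
definition of `d_ν`. With this extension the two sides have the same representative, so no
coboundary has to be produced. -/
theorem cohNormal_comp_cohMap_phi (hS : ∀ n, Function.Surjective (restrict S n))
    (hΦ : IsChainMapUpToSign (hω.phi G)) (k : ℕ) :
    G.cohNormal k ∘ₗ cohMap (hω.phi G) hΦ k = hω.cohNegFlatSymm k ∘ₗ dnu S hS k := by
  refine LinearMap.ext fun c => ?_
  obtain ⟨⟨α, hα⟩, rfl⟩ := Submodule.mkQ_surjective _ c
  have hα' : d α = 0 := hα
  have hr : restrict S k (extend G.prS k α) = α := restrict_extend _ G.prS_coe k α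
  have hr' : d (restrict S k (extend G.prS k α)) = 0 := by rw [hr, hα']
  -- Closedness of `α` removes the correction term `j (d α)`.
  have hd : G.dExtend k α = ⟨d (extend G.prS k α), d_extension_mem S _ hr'⟩ :=
    Subtype.ext (by
      change d (extend G.prS k α) - extend G.prS (k + 1) (d α) = _
      rw [hα', map_zero]
      exact sub_zero _)
  -- The value of `d_ν` is known on classes of restrictions of global forms, so `α` is rewritten as
  -- the restriction of `j α`.
  have hcls : cls α hα' = cls (restrict S k (extend G.prS k α)) hr' :=
    cls_eq _ _ (by rw [hr, sub_self]; exact zero_mem _)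
  have hφ : d (hω.phi G k α) = 0 := by
    rw [← neg_eq_zero, ← phi_d, hα', map_zero]
  have hn : d (mapCoeff G.toNormal k (hω.phi G k α)) = 0 := by
    rw [← mapCoeff_d G.toNormal G.toNormal_lie, hφ, map_zero]
  have h₁ : G.cohNormal k (cohMap (hω.phi G) hΦ k (cls α hα')) =
      cls (mapCoeff G.toNormal k (hω.phi G k α)) hn := by
    rw [cohMap_cls _ hΦ α hα' hφ]
    exact cohMap_cls _ _ _ hφ hn
  have e := hω.mapCoeff_toNormal_phi G k α
  rw [hd] at e
  have h₂ : hω.cohNegFlatSymm k (dnu S hS k (cls α hα')) =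
      cls (mapCoeff (-hω.flatEquiv.symm.toLinearMap) k
        (conormalPart S k ⟨d (extend G.prS k α), d_extension_mem S _ hr'⟩)) (e ▸ hn) := by
    -- `d_ν` is built from an arbitrarily chosen extension; its independence of that choice allows
    -- `j α` to be used instead.
    rw [hcls, dnu_cls S hS _ hr']
    exact cohMap_cls _ _ _ _ _
  refine h₁.trans (Eq.trans ?_ h₂.symm)
  -- The representatives agree by `e`.
  congr 1

end IsTransverselySymplectic

end LieForms

end

/-! ### The proposition for a foliation with a presymplectic form -/

theorem mainTheorem4 {E : Type*} [NormedAddCommGroup E] [NormedSpace ℝ E] [FiniteDimensional ℝ E]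
    {C : Type*} [TopologicalSpace C] [ChartedSpace E C] [IsManifold 𝓘(ℝ, E) ∞ C] [T2Space C]
    [SigmaCompactSpace C] (F : Foliation E C) (ωC : Form E C 2) (hω : F.IsPresymplectic ωC) :
    (∀ (G : SmoothDistribution E C) (hG : F.IsComplement G),
      (∀ (k : ℕ) (α : F.LeafForm k) (V : Fin k → F.tangent)
        (β : Module.Dual (SmoothFun E C) hG.Sections),
        β (hω.Phi hG k α V) =
          LieForms.d (hG.j k α)
            (Fin.snoc (fun i => (V i : VF E C)) ((hω.flat hG).symm β : VF E C))) ∧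
      (∀ (k : ℕ) (α : F.LeafForm k),
        hω.Phi hG (k + 1) (LieForms.d α) = -LieForms.d (hω.Phi hG k α)) ∧
      ∃ hΦ : LieForms.IsChainMapUpToSign (hω.Phi hG),
        ∀ k : ℕ, hω.cohPhi hG hΦ k = hω.cohNegFlatSymm k ∘ₗ F.dnu k) ∧
    ∀ (G G' : SmoothDistribution E C) (hG : F.IsComplement G) (hG' : F.IsComplement G')
      (hΦ : LieForms.IsChainMapUpToSign (hω.Phi hG))
      (hΦ' : LieForms.IsChainMapUpToSign (hω.Phi hG')) (k : ℕ),
      hω.cohPhi hG hΦ k = hω.cohPhi hG' hΦ' k := by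
  -- Stated for every witness `hΦ`, so that it serves both the existence claim and the comparison of
  -- two complements with arbitrary witnesses.
  have hcoh : ∀ (G : SmoothDistribution E C) (hG : F.IsComplement G)
      (hΦ : LieForms.IsChainMapUpToSign (hω.Phi hG)) (k : ℕ),
      hω.cohPhi hG hΦ k = hω.cohNegFlatSymm k ∘ₗ F.dnu k := fun G hG hΦ k =>
    -- The extensions behind `F.dnu` come from a projection glued by a partition of unity,
    -- independently of `G`.
    hω.isTransverselySymplectic.cohNormal_comp_cohMap_phi hG.toComplement F.restrict_surjective hΦ k
  refine ⟨fun G hG => ⟨?_, ?_, ?_⟩, fun G G' hG hG' hΦ hΦ' k => ?_⟩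
  · exact hω.isTransverselySymplectic.apply_phi hG.toComplement
  · exact hω.isTransverselySymplectic.phi_d hG.toComplement
  -- `Φ` is a chain map up to sign through the anticommuting alternative.
  · exact ⟨Or.inr (hω.isTransverselySymplectic.phi_d hG.toComplement), hcoh G hG _⟩
  -- Both maps equal `[-Id ⊗ (ω♭)⁻¹] ∘ d_ν`, in which no complement occurs.
  · rw [hcoh, hcoh]
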